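/- **Setting.** Fix $J$ goods, vectors $\boldsymbol l,\boldsymbol u\in\mathbb R^J$ with $l_j<u_j$ for all $j$, a margin $B\ge 0$ and $\pi\in[0,1]$. Prices range over the box $\mathcal S=\{\boldsymbol p:\ l_j\le p_j\le u_j \text{ for all } j\}$; write $\mathcal S_B=\{\boldsymbol p:\ l_j-B\le p_j\le u_j+B\text{ for all } j\}$. Norms of vectors are Euclidean and norms of matrices are operator norms. An individual type, drawn from a probability distribution $\Theta$, has demand and supply functions $\boldsymbol D_i(w,\cdot),\boldsymbol S_i(w,\cdot)$ with values in $\mathbb R^J$, $w\in\{0,1\}$, which depend measurably on the type, and excess demand $\boldsymbol Z_i=\boldsymbol D_i-\boldsymbol S_i$. Let $$\boldsymbol z_\pi(\boldsymbol p)=\pi\,\mathbb E[\boldsymbol Z_i(1,\boldsymbol p)]+(1-\pi)\,\mathbb E[\boldsymbol Z_i(0,\boldsymbol p)],$$ let $\boldsymbol p^*_\pi\in\mathcal S$ be a mean-field price, i.e. $\boldsymbol z_\pi(\boldsymbol p^*_\pi)=0$, and let $\boldsymbol H=\nabla_p\boldsymbol z_\pi(\boldsymbol p^*_\pi)$ be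 the Jacobian, $H_{jk}=\partial z_{\pi,j}/\partial p_k$ (derivatives of $\boldsymbol z_\pi$ are taken within $\mathcal S$, which matters only on its boundary). **Assumptions.** 1. All $\boldsymbol D_i(w,\cdot)$ and $\boldsymbol S_i(w,\cdot)$ are twice continuously differentiable on $\mathcal S_B$, and their derivatives of orders $0,1,2$ are bounded on $\mathcal S_B$ uniformly over $w$ and over types. 2. $\boldsymbol H$ has full rank, and $\boldsymbol f(\boldsymbol p)=\boldsymbol z_\pi(\boldsymbol p)+\boldsymbol p$ satisfies $\|\nabla_p\boldsymbol f(\boldsymbol p)\|<1$ for all $\boldsymbol p\in\mathcal S$. 3. There are $a_n$ with $n a_n\to0$ such that, for all sufficiently large $n$ and all vectors $\boldsymbol U_1,\dots,\boldsymbol U_n\in\mathbb R^J$ with $|U_{ij}|\le B$, almost surely (for i.i.d. types from $\Theta$ and independent i.i.d. treatments with $\mathbb P(W_i=1)=\pi$) there is $\boldsymbol p_n\in\mathcal S$ with $\big\|\frac1n\sum_{i=1}^n\boldsymbol Z_i(W_i,\boldsymbol p_n+\boldsymbol U_i)\big\|\le a_n$. Let $\boldsymbol V=\boldsymbol H^{-1}\,\mathbb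 E\big[\boldsymbol Z_i(W_i,\boldsymbol p^*_\pi)\boldsymbol Z_i(W_i,\boldsymbol p^*_\pi)^\top\big]\,(\boldsymbol H^{-1})^\top$, and let $\to_d$ denote convergence in distribution as $n\to\infty$ (weak convergence of laws). **(a)** For each $n$ let the types of $n$ individuals be i.i.d. from $\Theta$ and their treatments $W_i$ i.i.d. with $\mathbb P(W_i=1)=\pi$, independent of the types. Let $\boldsymbol P$ be a measurable choice of a market-clearing price, $\boldsymbol P\in\arg\min_{\boldsymbol p\in\mathcal S}\big\|\frac1n\sum_{i=1}^n\boldsymbol Z_i(W_i,\boldsymbol p)\big\|$. Then $\sqrt n(\boldsymbol P-\boldsymbol p^*_\pi)\to_d N(0,\boldsymbol V)$. **(b)** Suppose $B>0$. Let moreover $h_n=cn^{-\alpha}$ with $\alpha>\tfrac14$ and a constant $c$, and for each $n$ let the coordinates of the perturbations $\boldsymbol U_1,\dots,\boldsymbol U_n\in\mathbb R^J$ be i.i.d. uniform on $\{-h_n,h_n\}$, independent of types and treatments. Let $\tilde{\boldsymbol P}$ be a measurable choice of a market-clearing price of the perturbed system, $\tilde{\boldsymbol P}\in\arg\min_{\boldsymbol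 p\in\mathcal S}\big\|\frac1n\sum_{i=1}^n\boldsymbol Z_i(W_i,\boldsymbol p+\boldsymbol U_i)\big\|$. Then $\sqrt n(\tilde{\boldsymbol P}-\boldsymbol p^*_\pi)\to_d N(0,\boldsymbol V)$. -/

import Mathlib

open MeasureTheory ProbabilityTheory Filter Topology

namespace Market

noncomputable section

/-- Price vectors for `J` goods, with the Euclidean norm. -/
abbrev Price (J : ℕ) : Type := EuclideanSpace ℝ (Fin J)

/-- The box of price vectors `p` with `l j - r ≤ p j ≤ u j + r` for every good `j`. For `r = 0`
this is the price space `S = {p : l ≤ p ≤ u}`. -/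
def box {J : ℕ} (l u : Price J) (r : ℝ) : Set (Price J) :=
  {p | ∀ j, l j - r ≤ p j ∧ p j ≤ u j + r}

/-- Individual excess demand `Z(w, p) = D(w, p) - S(w, p)`. An individual is a point `g` of the
type space; the treatment is `w` (`true` for treated, `false` for control). -/
def excess {J : ℕ} {𝒢 : Type*} (D S : 𝒢 → Bool → Price J → Price J) (g : 𝒢) (w : Bool)
    (p : Price J) : Price J :=
  D g w p - S g w p

/-- Average excess demand `(1/n) ∑ i, Z_i (W_i, p + U_i)` of `n` individuals with types `x i` and
treatments `w i`, when individual `i` faces the price `p + U i`. -/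
def avgExcess {J : ℕ} {𝒢 : Type*} (D S : 𝒢 → Bool → Price J → Price J) {n : ℕ}
    (x : Fin n → 𝒢) (w : Fin n → Bool) (U : Fin n → Price J) (p : Price J) : Price J :=
  (1 / (n : ℝ)) • ∑ i, excess D S (x i) (w i) (p + U i)

/-- `p` is a market-clearing price of the finite market: among all prices in the price space, it
minimizes the norm of the average excess demand. Without perturbations, `U = 0`. -/
def IsMarketPrice {J : ℕ} {𝒢 : Type*} (D S : 𝒢 → Bool → Price J → Price J) (l u : Price J)
    {n : ℕ} (x : Fin n → 𝒢) (w : Fin n → Bool) (U : Fin n → Price J) (p : Price J) : Prop :=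
  p ∈ box l u 0 ∧ ∀ q ∈ box l u 0, ‖avgExcess D S x w U p‖ ≤ ‖avgExcess D S x w U q‖

/-- The law of a type and an independent treatment with `P (W = 1) = π`. -/
def agentLaw {𝒢 : Type*} [MeasurableSpace 𝒢] (Θ : Measure 𝒢) (π : unitInterval) :
    Measure (𝒢 × Bool) :=
  Θ.prod (bernoulliMeasure true false π)

/-- The law of a vector whose coordinates are independent and uniform on `{-h, h}`. -/
def perturbLaw (J : ℕ) (h : ℝ) : Measure (Price J) :=
  (Measure.pi fun _ : Fin J =>
    bernoulliMeasure h (-h) ⟨1 / 2, by norm_num, by norm_num⟩).map (WithLp.toLp 2)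

/-- The law of an independent triple of a type, a treatment and a price perturbation. -/
def perturbedAgentLaw {𝒢 : Type*} [MeasurableSpace 𝒢] (Θ : Measure 𝒢) (π : unitInterval)
    (J : ℕ) (h : ℝ) : Measure (𝒢 × Bool × Price J) :=
  Θ.prod ((bernoulliMeasure true false π).prod (perturbLaw J h))

/-- Mean-field excess demand
`z_π(p) = π (d(1, p) - s(1, p)) + (1 - π) (d(0, p) - s(0, p))`, where `d(w, p)` and `s(w, p)` are
the expected demand and supply. -/
def meanExcess {J : ℕ} {𝒢 : Type*} [MeasurableSpace 𝒢] (Θ : Measure 𝒢)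
    (D S : 𝒢 → Bool → Price J → Price J) (π : unitInterval) (p : Price J) : Price J :=
  (π : ℝ) • ((∫ g, D g true p ∂Θ) - ∫ g, S g true p ∂Θ) +
    (1 - (π : ℝ)) • ((∫ g, D g false p ∂Θ) - ∫ g, S g false p ∂Θ)

/-- The matrix `H` with entries `∂ z_j / ∂ p_k` at `p`, the derivative being taken within the
price space (at an interior point this is the usual derivative). -/
def jacobian {J : ℕ} {𝒢 : Type*} [MeasurableSpace 𝒢] (Θ : Measure 𝒢)
    (D S : 𝒢 → Bool → Price J → Price J) (π : unitInterval) (l u p : Price J) :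
    Matrix (Fin J) (Fin J) ℝ :=
  Matrix.of fun j k =>
    fderivWithin ℝ (meanExcess Θ D S π) (box l u 0) p (EuclideanSpace.single k 1) j

/-- The second moment matrix `E [Z(W, p) Z(W, p)ᵀ]`. -/
def secondMoment {J : ℕ} {𝒢 : Type*} [MeasurableSpace 𝒢] (Θ : Measure 𝒢)
    (D S : 𝒢 → Bool → Price J → Price J) (π : unitInterval) (p : Price J) :
    Matrix (Fin J) (Fin J) ℝ :=
  Matrix.of fun j k =>
    ∫ a, excess D S a.1 a.2 p j * excess D S a.1 a.2 p k ∂(agentLaw Θ π)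

/-- The sandwich covariance `H⁻¹ E [Z Zᵀ] (H⁻¹)ᵀ` at the price `p`. -/
def asympCov {J : ℕ} {𝒢 : Type*} [MeasurableSpace 𝒢] (Θ : Measure 𝒢)
    (D S : 𝒢 → Bool → Price J → Price J) (π : unitInterval) (l u p : Price J) :
    Matrix (Fin J) (Fin J) ℝ :=
  (jacobian Θ D S π l u p)⁻¹ * secondMoment Θ D S π p *
    ((jacobian Θ D S π l u p)⁻¹).transpose

/-- `p` is a mean-field price: a zero of the mean-field excess demand in the price space. -/
def IsMeanFieldPrice {J : ℕ} {𝒢 : Type*} [MeasurableSpace 𝒢] (Θ : Measure 𝒢)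
    (D S : 𝒢 → Bool → Price J → Price J) (π : unitInterval) (l u p : Price J) : Prop :=
  p ∈ box l u 0 ∧ meanExcess Θ D S π p = 0

/-- A family of response functions (demand or supply) is twice continuously differentiable in the
price on the set `K`, with derivatives of order `0`, `1`, `2` bounded uniformly over the price,
the treatment and the type. -/
structure IsRegular {J : ℕ} {𝒢 : Type*} [MeasurableSpace 𝒢]
    (F : 𝒢 → Bool → Price J → Price J) (K : Set (Price J)) : Prop where
  measurable : ∀ w, ∀ p ∈ K, Measurable fun g => F g w p
  contDiffOn : ∀ g w, ContDiffOn ℝ 2 (F g w) K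
  bounded : ∃ C : ℝ, ∀ g w, ∀ r ≤ 2, ∀ p ∈ K, ‖iteratedFDerivWithin ℝ r (F g w) K p‖ ≤ C

/-- The standing assumptions on the market, with price space `box l u 0`, mean-field price `pstar`
and a margin `B` for perturbations of individual prices. -/
structure Assumptions {J : ℕ} {𝒢 : Type*} [MeasurableSpace 𝒢] (Θ : Measure 𝒢)
    (D S : 𝒢 → Bool → Price J → Price J) (π : unitInterval) (l u : Price J) (B : ℝ)
    (pstar : Price J) : Prop where
  /-- Differentiability and boundedness of demand. -/
  demand_regular : IsRegular D (box l u B)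
  /-- Differentiability and boundedness of supply. -/
  supply_regular : IsRegular S (box l u B)
  /-- The Jacobian of the mean-field excess demand at the mean-field price has full rank. -/
  jacobian_full_rank : (jacobian Θ D S π l u pstar).rank = J
  /-- The derivative of `f(p) = z_π(p) + p` has operator norm smaller than one. -/
  contraction : ∀ p ∈ box l u 0,
    ‖fderivWithin ℝ (fun q => meanExcess Θ D S π q + q) (box l u 0) p‖ < 1
  /-- For large `n`, almost every sample of `n` individuals can be cleared up to `a n = o(1 / n)`
  by some price, whatever bounded noise is added to the individual prices. -/
  approx_clearing : ∃ a : ℕ → ℝ, Tendsto (fun n : ℕ => (n : ℝ) * a n) atTop (𝓝 0) ∧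
    ∀ᶠ n : ℕ in atTop, ∀ U : Fin n → Price J, (∀ i j, |U i j| ≤ B) →
      ∀ᵐ s ∂(Measure.pi fun _ : Fin n => agentLaw Θ π), ∃ p ∈ box l u 0,
        ‖avgExcess D S (fun i => (s i).1) (fun i => (s i).2) U p‖ ≤ a n

end

end Market

/-! The market price is a Z-estimator: an approximate zero of an average of i.i.d. smooth random
functions with mean `z_π`.

Consistency. The map `f = z_π + id` fixes every zero of `z_π`, and a derivative of norm below one
along a segment forbids two fixed points (`meanExcess_ne_zero`). Compactness makes the zero well
separated. A law of large numbers on a finite net, together with a uniform Lipschitz bound, keeps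
the sample average close to `z_π`, so a price with small average excess demand is close to `pstar`
(`vanishesInProbability_norm_sub_pstar`).

Normality. Put `δ = P - pstar` and expand each `Z_i` at `pstar` with displacement `δ + U i`. Since
the average clears up to `o(1/n)`, solving for `δ` gives `√n δ = -H⁻¹ n^(-1/2) ∑ Z_i(pstar)` plus
errors, which are bounded by a vanishing term plus a vanishing multiple of `‖√n δ‖`
(`norm_sqrt_smul_sub_le`). Tightness of the leading term absorbs that multiple
(`vanishesInProbability_norm_sub_of_le`), so no rate for `δ` has to be known beforehand. The central
limit theorem and Slutsky's lemma then give the limit.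

Perturbations add two errors: a first-order sum, centered with variance of order `h²`, and a
quadratic term of order `√n h²`, which vanishes for `α > 1/4`. Both claims are thus instances of
`tendstoInDistribution_sqrt_smul_sub_pstar`. -/

namespace Market

/-! ### Geometry of the price box -/

section Box

variable {J : ℕ} {l u : Price J} {r s : ℝ}

theorem box_mono (h : r ≤ s) : box l u r ⊆ box l u s := fun p hp j => by
  have := hp j
  constructor <;> linarith

theorem box_eq_iInter : box l u r =
    ⋂ j, (EuclideanSpace.proj j : Price J →L[ℝ] ℝ) ⁻¹' Set.Icc (l j - r) (u j + r) := by
  ext p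
  simp [box]

theorem convex_box : Convex ℝ (box l u r) := by
  rw [box_eq_iInter]
  exact convex_iInter fun j =>
    (convex_Icc _ _).linear_preimage (EuclideanSpace.proj j : Price J →L[ℝ] ℝ).toLinearMap

theorem isCompact_box : IsCompact (box l u r) := by
  have h : box l u r = (EuclideanSpace.equiv (Fin J) ℝ) ⁻¹'
      (Set.univ.pi fun j => Set.Icc (l j - r) (u j + r)) := by
    ext p
    simp only [box, Set.mem_ofPred_eq, Set.mem_preimage, Set.mem_univ_pi, Set.mem_Icc]
    rfl
  rw [h]
  exact (EuclideanSpace.equiv (Fin J) ℝ).toHomeomorph.isCompact_preimage.2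
    (isCompact_univ_pi fun _ => isCompact_Icc)

theorem uniqueDiffOn_box (hlu : ∀ j, l j < u j) (hr : 0 ≤ r) :
    UniqueDiffOn ℝ (box l u r) := by
  refine uniqueDiffOn_convex convex_box ⟨(1 / 2 : ℝ) • (l + u), ?_⟩
  refine mem_interior.2 ⟨⋂ j, (EuclideanSpace.proj j : Price J →L[ℝ] ℝ) ⁻¹' Set.Ioo (l j) (u j),
    ?_, ?_, ?_⟩
  · intro p hp j
    have : l j < p j ∧ p j < u j := Set.mem_iInter.1 hp j
    constructor <;> linarith
  · exact isOpen_iInter_of_finite fun j => isOpen_Ioo.preimage (EuclideanSpace.proj j).continuous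
  · refine Set.mem_iInter.2 fun j => ?_
    have := hlu j
    change l j < (1 / 2 : ℝ) * (l j + u j) ∧ (1 / 2 : ℝ) * (l j + u j) < u j
    constructor <;> linarith

theorem add_mem_box {p v : Price J} (hp : p ∈ box l u 0) (hv : ∀ j, |v j| ≤ r) :
    p + v ∈ box l u r := fun j => by
  have h1 := hp j
  have h2 := abs_le.1 (hv j)
  rw [PiLp.add_apply]
  constructor <;> linarith

/-- From any point of the box one can move in both senses of some coordinate direction: `e_k` is a
multiple of the displacement to another point of the box. -/
theorem exists_mem_box_smul_sub_eq_single (hlu : ∀ j, l j < u j) {p : Price J}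
    (hp : p ∈ box l u 0) (k : Fin J) :
    ∃ q ∈ box l u 0, ∃ t : ℝ, EuclideanSpace.single k 1 = t • (q - p) := by
  have key : ∀ d : ℝ, d ≠ 0 → l k ≤ p k + d → p k + d ≤ u k →
      ∃ q ∈ box l u 0, ∃ t : ℝ, EuclideanSpace.single k 1 = t • (q - p) := by
    intro d hd h1 h2
    refine ⟨p + d • EuclideanSpace.single k 1, fun j => ?_, d⁻¹, ?_⟩
    · have := hp j
      by_cases hj : j = k
      · subst hj
        simp [h1, h2]
      · simpa [hj] using this
    · rw [add_sub_cancel_left, inv_smul_smul₀ hd]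
  have h := hp k
  have hk := hlu k
  simp only [sub_zero, add_zero] at h
  rcases lt_or_ge (p k) (u k) with h' | h'
  -- Move all the way to a face: the upper one unless `p` already lies on it, and then the lower
  -- one.
  · exact key (u k - p k) (by linarith) (by linarith) (by linarith)
  · exact key (l k - p k) (by linarith) (by linarith) (by linarith)

end Box

/-! ### Uniform Taylor bounds and measurability for individual responses -/

section Regular

variable {J : ℕ} {𝒢 : Type*} [MeasurableSpace 𝒢] {D S F : 𝒢 → Bool → Price J → Price J}
  {l u : Price J} {B : ℝ}

theorem isRegular_excess {K : Set (Price J)} (hK : UniqueDiffOn ℝ K) (hD : IsRegular D K)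
    (hS : IsRegular S K) : IsRegular (excess D S) K where
  measurable w p hp := (hD.measurable w p hp).sub (hS.measurable w p hp)
  contDiffOn g w := (hD.contDiffOn g w).sub (hS.contDiffOn g w)
  bounded := by
    obtain ⟨C₁, h₁⟩ := hD.bounded
    obtain ⟨C₂, h₂⟩ := hS.bounded
    refine ⟨C₁ + C₂, fun g w r hr p hp => ?_⟩
    have hr' : ((r : ℕ) : WithTop ℕ∞) ≤ 2 := by exact_mod_cast hr
    have : excess D S g w = D g w - S g w := rfl
    rw [this, iteratedFDerivWithin_sub_apply ((hD.contDiffOn g w p hp).of_le hr')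
      ((hS.contDiffOn g w p hp).of_le hr') hK hp]
    exact (norm_sub_le _ _).trans (add_le_add (h₁ g w r hr p hp) (h₂ g w r hr p hp))

theorem IsRegular.differentiableOn {K : Set (Price J)} (hF : IsRegular F K) (g : 𝒢) (w : Bool) :
    DifferentiableOn ℝ (F g w) K :=
  (hF.contDiffOn g w).differentiableOn (by norm_num)

/-- Convexity turns the bound on the first derivative into a Lipschitz bound, and the bound on the
second into a quadratic Taylor remainder. One constant serves all types and treatments, so the
estimates survive averaging and integration. -/
theorem IsRegular.exists_bounds {K : Set (Price J)} (hF : IsRegular F K) (hK : UniqueDiffOn ℝ K)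
    (hc : Convex ℝ K) : ∃ C : ℝ, 0 ≤ C ∧
      (∀ g w, ∀ p ∈ K, ‖F g w p‖ ≤ C) ∧
      (∀ g w, ∀ p ∈ K, ‖fderivWithin ℝ (F g w) K p‖ ≤ C) ∧
      (∀ g w, ∀ p ∈ K, ∀ q ∈ K, ‖F g w q - F g w p‖ ≤ C * ‖q - p‖) ∧
      (∀ g w, ∀ p ∈ K, ∀ q ∈ K,
        ‖F g w q - F g w p - fderivWithin ℝ (F g w) K p (q - p)‖ ≤ C * ‖q - p‖ ^ 2) := by
  obtain ⟨C₀, h₀⟩ := hF.bounded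
  have h : ∀ g w, ∀ r ≤ 2, ∀ p ∈ K, ‖iteratedFDerivWithin ℝ r (F g w) K p‖ ≤ |C₀| :=
    fun g w r hr p hp => (h₀ g w r hr p hp).trans (le_abs_self _)
  have hd : ∀ g w, ∀ p ∈ K, ‖fderivWithin ℝ (F g w) K p‖ ≤ |C₀| := fun g w p hp => by
    rw [← norm_iteratedFDerivWithin_one _ (hK p hp)]
    exact h g w 1 (by norm_num) p hp
  have hd2 : ∀ g w, ∀ p ∈ K, ‖fderivWithin ℝ (fderivWithin ℝ (F g w) K) K p‖ ≤ |C₀| :=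
    fun g w p hp => by
      rw [← norm_iteratedFDerivWithin_one _ (hK p hp),
        norm_iteratedFDerivWithin_fderivWithin hK hp]
      exact h g w 2 le_rfl p hp
  have hdd : ∀ g w, DifferentiableOn ℝ (fderivWithin ℝ (F g w) K) K := fun g w =>
    ((hF.contDiffOn g w).fderivWithin hK (m := 1) (by norm_num)).differentiableOn (by norm_num)
  refine ⟨|C₀|, abs_nonneg _, fun g w p hp => ?_, hd, fun g w p hp q hq => ?_,
    fun g w p hp q hq => ?_⟩
  · rw [← norm_iteratedFDerivWithin_zero (𝕜 := ℝ) (s := K)]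
    exact h g w 0 (by norm_num) p hp
  · exact hc.norm_image_sub_le_of_norm_fderivWithin_le (hF.differentiableOn g w) (hd g w) hp hq
  · have hseg : segment ℝ p q ⊆ K := hc.segment_subset hp hq
    -- Mean value inequality with the derivative compared to its value at `p`: on the segment the
    -- two differ by at most `|C₀| * ‖q - p‖`.
    have := (convex_segment p q).norm_image_sub_le_of_norm_hasFDerivWithin_le'
      (f := F g w) (f' := fderivWithin ℝ (F g w) K) (φ := fderivWithin ℝ (F g w) K p)
      (C := |C₀| * ‖q - p‖)
      (fun x hx => ((hF.differentiableOn g w x (hseg hx)).hasFDerivWithinAt).mono hseg)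
      (fun x hx => (hc.norm_image_sub_le_of_norm_fderivWithin_le (hdd g w) (hd2 g w) hp
        (hseg hx)).trans (mul_le_mul_of_nonneg_left (norm_sub_le_of_mem_segment hx) (abs_nonneg _)))
      (left_mem_segment ℝ p q) (right_mem_segment ℝ p q)
    rwa [mul_assoc, ← sq] at this

/-- Directional derivatives are limits of difference quotients, hence measurable in the type. -/
theorem IsRegular.measurable_fderivWithin_sub {K : Set (Price J)} (hF : IsRegular F K)
    (hK : UniqueDiffOn ℝ K) (hc : Convex ℝ K) {p q : Price J} (hp : p ∈ K) (hq : q ∈ K)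
    (w : Bool) : Measurable fun g => fderivWithin ℝ (F g w) K p (q - p) := by
  obtain ⟨C, hC, -, -, -, h⟩ := hF.exists_bounds hK hc
  -- Step lengths in `(0, 1]` keep the difference quotients inside the convex set.
  let t : ℕ → ℝ := fun n => ((n : ℝ) + 1)⁻¹
  have ht : ∀ n, 0 < t n := fun n => by positivity
  have ht1 : ∀ n, t n ≤ 1 := fun n => inv_le_one_of_one_le₀ (by simp)
  have htlim : Tendsto t atTop (𝓝 0) := tendsto_inv_atTop_zero.comp
    (tendsto_atTop_add_const_right _ _ tendsto_natCast_atTop_atTop)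
  have hmem : ∀ n, p + t n • (q - p) ∈ K := fun n =>
    hc.add_smul_sub_mem hp hq ⟨(ht n).le, ht1 n⟩
  refine measurable_of_tendsto_metrizable
    (f := fun n g => (t n)⁻¹ • (F g w (p + t n • (q - p)) - F g w p))
    (fun n => (measurable_const_smul (t n)⁻¹).comp
      ((hF.measurable w _ (hmem n)).sub (hF.measurable w p hp))) ?_
  refine tendsto_pi_nhds.2 fun g => tendsto_iff_norm_sub_tendsto_zero.2 ?_
  refine squeeze_zero (fun _ => norm_nonneg _) (fun n => ?_)
    (by simpa using htlim.const_mul (C * ‖q - p‖ ^ 2))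
  have h1 := h g w p hp _ (hmem n)
  rw [add_sub_cancel_left, map_smul, norm_smul, Real.norm_of_nonneg (ht n).le] at h1
  have : (t n)⁻¹ • (F g w (p + t n • (q - p)) - F g w p) - fderivWithin ℝ (F g w) K p (q - p)
      = (t n)⁻¹ • (F g w (p + t n • (q - p)) - F g w p
        - t n • fderivWithin ℝ (F g w) K p (q - p)) := by
    simp only [smul_sub, inv_smul_smul₀ (ht n).ne']
  rw [this, norm_smul, norm_inv, Real.norm_of_nonneg (ht n).le, inv_mul_le_iff₀ (ht n)]
  calc _ ≤ _ := h1
    _ = _ := by ring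

theorem IsRegular.measurable_uncurry {K : Set (Price J)} (hF : IsRegular F K) {p : Price J}
    (hp : p ∈ K) : Measurable fun a : 𝒢 × Bool => F a.1 a.2 p :=
  measurable_from_prod_countable_left fun w => hF.measurable w p hp

theorem IsRegular.measurable_fderivWithin (hF : IsRegular F (box l u B)) (hlu : ∀ j, l j < u j)
    (hB : 0 ≤ B) {p : Price J} (hp : p ∈ box l u 0) (k : Fin J) :
    Measurable fun a : 𝒢 × Bool =>
      fderivWithin ℝ (F a.1 a.2) (box l u B) p (EuclideanSpace.single k 1) := by
  refine measurable_from_prod_countable_left fun w => ?_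
  obtain ⟨q, hq, t, ht⟩ := exists_mem_box_smul_sub_eq_single hlu hp k
  simp only [ht, map_smul]
  exact (measurable_const_smul t).comp (hF.measurable_fderivWithin_sub (uniqueDiffOn_box hlu hB)
    convex_box (box_mono hB hp) (box_mono hB hq) w)

end Regular

/-! ### Mean-field excess demand: derivative and separation of its zero -/

section MeanField

variable {J : ℕ} {𝒢 : Type*} [MeasurableSpace 𝒢] {Θ : Measure 𝒢}
  {D S : 𝒢 → Bool → Price J → Price J} {π : unitInterval} {l u : Price J} {B : ℝ}

/-- The expected value of the derivative of the individual excess demand. -/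
noncomputable def meanDeriv (Θ : Measure 𝒢) (D S : 𝒢 → Bool → Price J → Price J)
    (π : unitInterval) (l u : Price J) (B : ℝ) (p : Price J) : Price J →L[ℝ] Price J :=
  ∑ k, (EuclideanSpace.proj k : Price J →L[ℝ] ℝ).smulRight
    (∫ a, fderivWithin ℝ (excess D S a.1 a.2) (box l u B) p (EuclideanSpace.single k 1)
      ∂(agentLaw Θ π))

theorem sum_smul_map_single {F : Type*} [NormedAddCommGroup F] [NormedSpace ℝ F]
    (A : Price J →L[ℝ] F) (v : Price J) :
    A v = ∑ k, v k • A (EuclideanSpace.single k 1) := by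
  conv_lhs => rw [← (EuclideanSpace.basisFun (Fin J) ℝ).sum_repr v]
  simp [map_sum]

theorem meanDeriv_single (p : Price J) (k : Fin J) :
    meanDeriv Θ D S π l u B p (EuclideanSpace.single k 1) =
      ∫ a, fderivWithin ℝ (excess D S a.1 a.2) (box l u B) p (EuclideanSpace.single k 1)
        ∂(agentLaw Θ π) := by
  simp [meanDeriv]

variable [IsProbabilityMeasure Θ]

instance : IsProbabilityMeasure (agentLaw Θ π) := by
  unfold agentLaw
  infer_instance

theorem IsRegular.integrable {F : 𝒢 → Bool → Price J → Price J} {K : Set (Price J)}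
    (hF : IsRegular F K) {p : Price J} (hp : p ∈ K) :
    Integrable (fun a : 𝒢 × Bool => F a.1 a.2 p) (agentLaw Θ π) := by
  obtain ⟨C, hC⟩ := hF.bounded
  refine Integrable.of_bound (hF.measurable_uncurry hp).aestronglyMeasurable C
    (ae_of_all _ fun a => ?_)
  rw [← norm_iteratedFDerivWithin_zero (𝕜 := ℝ) (s := K)]
  exact hC a.1 a.2 0 (by norm_num) p hp

theorem IsRegular.integrable_type {F : 𝒢 → Bool → Price J → Price J} {K : Set (Price J)}
    (hF : IsRegular F K) {p : Price J} (hp : p ∈ K) (w : Bool) :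
    Integrable (fun g => F g w p) Θ := by
  obtain ⟨C, hC⟩ := hF.bounded
  refine Integrable.of_bound (hF.measurable w p hp).aestronglyMeasurable C
    (ae_of_all _ fun g => ?_)
  rw [← norm_iteratedFDerivWithin_zero (𝕜 := ℝ) (s := K)]
  exact hC g w 0 (by norm_num) p hp

theorem integrable_fderivWithin (hZ : IsRegular (excess D S) (box l u B))
    (hlu : ∀ j, l j < u j) (hB : 0 ≤ B) {p : Price J} (hp : p ∈ box l u 0) (k : Fin J) :
    Integrable (fun a : 𝒢 × Bool => fderivWithin ℝ (excess D S a.1 a.2) (box l u B) p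
      (EuclideanSpace.single k 1)) (agentLaw Θ π) := by
  obtain ⟨C, -, -, hC, -⟩ := hZ.exists_bounds (uniqueDiffOn_box hlu hB) convex_box
  refine Integrable.of_bound (hZ.measurable_fderivWithin hlu hB hp k).aestronglyMeasurable C
    (ae_of_all _ fun a => ?_)
  refine (ContinuousLinearMap.le_opNorm _ _).trans ?_
  simpa using hC a.1 a.2 p (box_mono hB hp)

theorem meanDeriv_apply (hZ : IsRegular (excess D S) (box l u B))
    (hlu : ∀ j, l j < u j) (hB : 0 ≤ B) {p : Price J} (hp : p ∈ box l u 0) (v : Price J) :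
    Integrable (fun a : 𝒢 × Bool => fderivWithin ℝ (excess D S a.1 a.2) (box l u B) p v)
      (agentLaw Θ π) ∧
    meanDeriv Θ D S π l u B p v =
      ∫ a, fderivWithin ℝ (excess D S a.1 a.2) (box l u B) p v ∂(agentLaw Θ π) := by
  have hint : ∀ k, Integrable (fun a : 𝒢 × Bool => v k • fderivWithin ℝ (excess D S a.1 a.2)
      (box l u B) p (EuclideanSpace.single k 1)) (agentLaw Θ π) :=
    fun k => (integrable_fderivWithin hZ hlu hB hp k).smul (v k)
  rw [sum_smul_map_single]
  simp only [meanDeriv_single, fun a : 𝒢 × Bool =>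
    sum_smul_map_single (fderivWithin ℝ (excess D S a.1 a.2) (box l u B) p) v]
  refine ⟨integrable_finsetSum _ fun k _ => hint k, ?_⟩
  rw [integral_finsetSum _ fun k _ => hint k]
  simp only [integral_smul]

theorem meanExcess_eq_integral {K : Set (Price J)} (hD : IsRegular D K) (hS : IsRegular S K)
    (hZ : IsRegular (excess D S) K) {p : Price J} (hp : p ∈ K) :
    meanExcess Θ D S π p = ∫ a, excess D S a.1 a.2 p ∂(agentLaw Θ π) := by
  have hi := hZ.integrable (Θ := Θ) (π := π) hp
  unfold agentLaw at hi ⊢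
  rw [integral_prod _ hi]
  simp only [integral_bernoulliMeasure]
  rw [integral_add ((hZ.integrable_type hp true).fun_smul _)
    ((hZ.integrable_type hp false).fun_smul _),
    integral_smul, integral_smul]
  simp only [excess]
  rw [integral_sub (hD.integrable_type hp true) (hS.integrable_type hp true),
    integral_sub (hD.integrable_type hp false) (hS.integrable_type hp false), meanExcess]

/-- The individual Taylor remainder is bounded uniformly over types, so it can be integrated;
differentiation under the expectation follows. -/
theorem norm_meanExcess_sub_sub_le (hD : IsRegular D (box l u B)) (hS : IsRegular S (box l u B))
    (hlu : ∀ j, l j < u j) (hB : 0 ≤ B) : ∃ C : ℝ, ∀ p ∈ box l u 0, ∀ q ∈ box l u 0,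
      ‖meanExcess Θ D S π q - meanExcess Θ D S π p - meanDeriv Θ D S π l u B p (q - p)‖
        ≤ C * ‖q - p‖ ^ 2 := by
  have hK := uniqueDiffOn_box hlu hB
  have hZ := isRegular_excess hK hD hS
  obtain ⟨C, -, -, -, -, hC⟩ := hZ.exists_bounds hK convex_box
  refine ⟨C, fun p hp q hq => ?_⟩
  have hp' := box_mono hB hp
  have hq' := box_mono hB hq
  obtain ⟨h1, h2⟩ := meanDeriv_apply (Θ := Θ) (π := π) hZ hlu hB hp (q - p)
  have hd : Integrable (fun a : 𝒢 × Bool => excess D S a.1 a.2 q - excess D S a.1 a.2 p)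
      (agentLaw Θ π) := (hZ.integrable hq').sub (hZ.integrable hp')
  have h3 : meanExcess Θ D S π q - meanExcess Θ D S π p - meanDeriv Θ D S π l u B p (q - p) =
      ∫ a, (excess D S a.1 a.2 q - excess D S a.1 a.2 p -
        fderivWithin ℝ (excess D S a.1 a.2) (box l u B) p (q - p)) ∂(agentLaw Θ π) := by
    rw [meanExcess_eq_integral hD hS hZ hp', meanExcess_eq_integral hD hS hZ hq', h2,
      integral_sub hd h1, integral_sub (hZ.integrable hq') (hZ.integrable hp')]
  have h4 := norm_integral_le_of_norm_le_const (μ := agentLaw Θ π) (C := C * ‖q - p‖ ^ 2)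
    (ae_of_all _ fun a : 𝒢 × Bool => hC a.1 a.2 p hp' q hq')
  rwa [← h3, probReal_univ, mul_one] at h4

theorem hasFDerivWithinAt_meanExcess (hD : IsRegular D (box l u B))
    (hS : IsRegular S (box l u B)) (hlu : ∀ j, l j < u j) (hB : 0 ≤ B) {p : Price J}
    (hp : p ∈ box l u 0) :
    HasFDerivWithinAt (meanExcess Θ D S π) (meanDeriv Θ D S π l u B p) (box l u 0) p := by
  obtain ⟨C, hC⟩ := norm_meanExcess_sub_sub_le (Θ := Θ) (π := π) hD hS hlu hB
  rw [hasFDerivWithinAt_iff_isLittleO]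
  refine Asymptotics.IsBigO.trans_isLittleO (g := fun q => ‖q - p‖ ^ 2) ?_ ?_
  · refine Asymptotics.IsBigO.of_bound C ?_
    filter_upwards [self_mem_nhdsWithin] with q hq
    simpa using hC p hp q hq
  · refine ((Asymptotics.isLittleO_norm_pow_id (E' := Price J) one_lt_two).comp_tendsto
      (k := fun q => q - p) ?_)
    have : Tendsto (fun q => q - p) (𝓝 p) (𝓝 (p - p)) :=
      (continuous_id.sub continuous_const).tendsto p
    rw [sub_self] at this
    exact this.mono_left nhdsWithin_le_nhds

/-- Links two derivatives: `jacobian` differentiates the mean within the price box, `meanDeriv`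
averages derivatives taken within the enlarged box. Derivatives within the price box are unique, so
they agree. -/
theorem toEuclideanCLM_jacobian (hD : IsRegular D (box l u B))
    (hS : IsRegular S (box l u B)) (hlu : ∀ j, l j < u j) (hB : 0 ≤ B) {p : Price J}
    (hp : p ∈ box l u 0) :
    Matrix.toEuclideanCLM (𝕜 := ℝ) (jacobian Θ D S π l u p) = meanDeriv Θ D S π l u B p := by
  refine ContinuousLinearMap.ext fun v => ?_
  ext j
  rw [sum_smul_map_single (meanDeriv Θ D S π l u B p)]
  simp only [Matrix.ofLp_toEuclideanCLM, Matrix.mulVec, dotProduct, jacobian, Matrix.of_apply,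
    (hasFDerivWithinAt_meanExcess (Θ := Θ) (π := π) hD hS hlu hB hp).fderivWithin
      (uniqueDiffOn_box hlu le_rfl p hp), WithLp.ofLp_sum, Finset.sum_apply, PiLp.smul_apply,
    smul_eq_mul, mul_comm]

/-- With two zeros, `f` fixes both. The scalar mean value theorem for `⟨p - pstar, f(·)⟩` on the
segment yields `x` with `‖p - pstar‖² = ⟨p - pstar, ∇f(x)(p - pstar)⟩`, which contradicts `‖∇f(x)‖ <
1`. The bound is needed only pointwise, with no uniform contraction constant. -/
theorem meanExcess_ne_zero (hD : IsRegular D (box l u B)) (hS : IsRegular S (box l u B))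
    (hlu : ∀ j, l j < u j) (hB : 0 ≤ B)
    (hcon : ∀ p ∈ box l u 0,
      ‖fderivWithin ℝ (fun q => meanExcess Θ D S π q + q) (box l u 0) p‖ < 1)
    {pstar p : Price J} (hstar : IsMeanFieldPrice Θ D S π l u pstar) (hp : p ∈ box l u 0)
    (hne : p ≠ pstar) : meanExcess Θ D S π p ≠ 0 := by
  intro h0
  have hd : ∀ x ∈ box l u 0, HasFDerivWithinAt (fun q => meanExcess Θ D S π q + q)
      (fderivWithin ℝ (fun q => meanExcess Θ D S π q + q) (box l u 0) x) (box l u 0) x :=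
    fun x hx => ((hasFDerivWithinAt_meanExcess hD hS hlu hB hx).add
      (hasFDerivWithinAt_id x _)).differentiableWithinAt.hasFDerivWithinAt
  obtain ⟨x, hx, h⟩ := domain_mvt
    (fun x hx => (innerSL ℝ (p - pstar)).hasFDerivAt.comp_hasFDerivWithinAt x (hd x hx))
    convex_box hstar.1 hp
  have hxS := convex_box.segment_subset hstar.1 hp hx
  simp only [Function.comp_apply, h0, hstar.2, zero_add, ContinuousLinearMap.comp_apply,
    innerSL_apply_apply, ← inner_sub_right, real_inner_self_eq_norm_sq] at h
  have hpos : 0 < ‖p - pstar‖ := norm_pos_iff.2 (sub_ne_zero.2 hne)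
  have h1 := real_inner_le_norm (p - pstar)
    (fderivWithin ℝ (fun q => meanExcess Θ D S π q + q) (box l u 0) x (p - pstar))
  have h2 := ContinuousLinearMap.le_opNorm
    (fderivWithin ℝ (fun q => meanExcess Θ D S π q + q) (box l u 0) x) (p - pstar)
  have h3 := hcon x hxS
  nlinarith [mul_pos hpos hpos]

/-- The mean-field price is a well-separated zero of the mean-field excess demand. -/
theorem exists_norm_meanExcess_lt_imp (hD : IsRegular D (box l u B))
    (hS : IsRegular S (box l u B)) (hlu : ∀ j, l j < u j) (hB : 0 ≤ B)
    (hcon : ∀ p ∈ box l u 0,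
      ‖fderivWithin ℝ (fun q => meanExcess Θ D S π q + q) (box l u 0) p‖ < 1)
    {pstar : Price J} (hstar : IsMeanFieldPrice Θ D S π l u pstar) {ε : ℝ} (hε : 0 < ε) :
    ∃ ρ > 0, ∀ p ∈ box l u 0, ‖meanExcess Θ D S π p‖ < ρ → ‖p - pstar‖ < ε := by
  have hcomp : IsCompact (box l u 0 \ Metric.ball pstar ε) := isCompact_box.diff Metric.isOpen_ball
  rcases (box l u 0 \ Metric.ball pstar ε).eq_empty_or_nonempty with he | hne
  · refine ⟨1, one_pos, fun p hp _ => ?_⟩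
    by_contra hcontra
    have : p ∈ box l u 0 \ Metric.ball pstar ε := ⟨hp, by simpa [dist_eq_norm] using hcontra⟩
    simp [he] at this
  · have hcont : ContinuousOn (fun p => ‖meanExcess Θ D S π p‖) (box l u 0) := fun p hp =>
      (hasFDerivWithinAt_meanExcess hD hS hlu hB hp).continuousWithinAt.norm
    -- The separation `ρ` is the minimum of `‖z_π‖` over the part of the box outside the ball.
    obtain ⟨q, hq, hmin⟩ := hcomp.exists_isMinOn hne (hcont.mono Set.sdiff_subset)
    refine ⟨‖meanExcess Θ D S π q‖, norm_pos_iff.2 (meanExcess_ne_zero hD hS hlu hB hcon hstar hq.1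
      fun h => hq.2 (by simpa [h] using hε)), fun p hp hlt => ?_⟩
    by_contra hcontra
    exact absurd (hmin ⟨hp, by simpa [dist_eq_norm] using hcontra⟩ :
      ‖meanExcess Θ D S π q‖ ≤ ‖meanExcess Θ D S π p‖) (not_le.2 hlt)

end MeanField

/-! ### Calculus of convergence in probability and tightness -/

section VanishesInProbability

variable {Ω : Type*} [MeasurableSpace Ω] {μ : Measure Ω}

/-- The positive part of the real random variables `f n` tends to zero in probability. For
`f n = ‖Y n‖` this is convergence of `Y n` to zero in probability. -/
def VanishesInProbability (μ : Measure Ω) (f : ℕ → Ω → ℝ) : Prop :=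
  ∀ ε > 0, Tendsto (fun n => μ {ω | ε ≤ f n ω}) atTop (𝓝 0)

/-- The upper tails of the real random variables `f n` are uniformly small. -/
def UniformlyTight (μ : Measure Ω) (f : ℕ → Ω → ℝ) : Prop :=
  ∀ δ > 0, ∃ M > 0, ∀ᶠ n in atTop, μ {ω | M ≤ f n ω} ≤ δ

theorem VanishesInProbability.mono_of_measure_le {f g : ℕ → Ω → ℝ}
    (h : ∀ ε > 0, ∃ ε' > 0, ∀ᶠ n in atTop, μ {ω | ε ≤ f n ω} ≤ μ {ω | ε' ≤ g n ω})
    (hg : VanishesInProbability μ g) : VanishesInProbability μ f := fun ε hε => by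
  obtain ⟨ε', hε', hle⟩ := h ε hε
  exact tendsto_of_tendsto_of_tendsto_of_le_of_le' tendsto_const_nhds (hg ε' hε')
    (Eventually.of_forall fun _ => zero_le) hle

theorem VanishesInProbability.mono {f g : ℕ → Ω → ℝ} (hg : VanishesInProbability μ g)
    (h : ∀ᶠ n in atTop, ∀ᵐ ω ∂μ, f n ω ≤ g n ω) : VanishesInProbability μ f := by
  refine VanishesInProbability.mono_of_measure_le (fun ε hε => ⟨ε, hε, ?_⟩) hg
  filter_upwards [h] with n hn
  refine measure_mono_ae ?_
  filter_upwards [hn] with ω hω h' using le_trans h' hω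

theorem VanishesInProbability.add {f g : ℕ → Ω → ℝ} (hf : VanishesInProbability μ f)
    (hg : VanishesInProbability μ g) : VanishesInProbability μ fun n ω => f n ω + g n ω := by
  intro ε hε
  have h := (hf (ε / 2) (by positivity)).add (hg (ε / 2) (by positivity))
  rw [add_zero] at h
  refine tendsto_of_tendsto_of_tendsto_of_le_of_le tendsto_const_nhds h (fun _ => zero_le)
    fun n => ?_
  refine (measure_mono fun ω (hω : ε ≤ f n ω + g n ω) => ?_).trans (measure_union_le _ _)
  by_contra hcon
  have h1 : ¬ ε / 2 ≤ f n ω := fun h => hcon (Or.inl h)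
  have h2 : ¬ ε / 2 ≤ g n ω := fun h => hcon (Or.inr h)
  linarith

theorem VanishesInProbability.of_tendsto {f : ℕ → ℝ} (hf : Tendsto f atTop (𝓝 0)) :
    VanishesInProbability μ fun n _ => f n := by
  intro ε hε
  refine tendsto_const_nhds.congr' ?_
  filter_upwards [hf.eventually_lt_const hε] with n hn
  simp [not_le.2 hn]

theorem VanishesInProbability.sum {ι : Type*} (s : Finset ι) {f : ι → ℕ → Ω → ℝ}
    (hf : ∀ i ∈ s, VanishesInProbability μ (f i)) :
    VanishesInProbability μ fun n ω => ∑ i ∈ s, f i n ω := by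
  classical
  induction s using Finset.induction_on with
  | empty => simpa using VanishesInProbability.of_tendsto tendsto_const_nhds
  | insert a s ha ih =>
    simp only [Finset.sum_insert ha]
    exact (hf a (Finset.mem_insert_self a s)).add
      (ih fun i hi => hf i (Finset.mem_insert_of_mem hi))

theorem VanishesInProbability.const_mul {f : ℕ → Ω → ℝ} (hf : VanishesInProbability μ f)
    {c : ℝ} (hc : 0 ≤ c) : VanishesInProbability μ fun n ω => c * f n ω := by
  -- Dividing by `c + 1` instead of `c` covers `c = 0`.
  refine VanishesInProbability.mono_of_measure_le (fun ε hε => ⟨ε / (c + 1), by positivity, ?_⟩) hf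
  refine Eventually.of_forall fun n => measure_mono fun ω (hω : ε ≤ c * f n ω) => ?_
  change ε / (c + 1) ≤ f n ω
  rw [div_le_iff₀ (by positivity)]
  have : 0 ≤ f n ω := by
    by_contra h
    nlinarith
  nlinarith

/-- Truncation: a product of size `ε` forces either the tight factor above `M` or the vanishing one
above `ε / M`. -/
theorem VanishesInProbability.mul_uniformlyTight {f g : ℕ → Ω → ℝ}
    (hf : VanishesInProbability μ f) (hf0 : ∀ n ω, 0 ≤ f n ω) (hg : UniformlyTight μ g) :
    VanishesInProbability μ fun n ω => f n ω * g n ω := by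
  intro ε hε
  refine ENNReal.tendsto_nhds_zero.2 fun δ hδ => ?_
  obtain ⟨M, hM, hgM⟩ := hg (δ / 2) (ENNReal.half_pos hδ.ne')
  filter_upwards [hgM, ENNReal.tendsto_nhds_zero.1 (hf (ε / M) (by positivity)) (δ / 2)
    (ENNReal.half_pos hδ.ne')] with n h1 h2
  rw [← ENNReal.add_halves δ]
  refine (measure_mono fun ω (hω : ε ≤ f n ω * g n ω) => ?_).trans
    ((measure_union_le _ _).trans (add_le_add h2 h1))
  by_contra hcon
  have h3 : f n ω < ε / M := not_le.1 fun h => hcon (Or.inl h)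
  have h4 : g n ω < M := not_le.1 fun h => hcon (Or.inr h)
  rw [lt_div_iff₀ hM] at h3
  nlinarith [hf0 n ω, mul_le_mul_of_nonneg_left h4.le (hf0 n ω)]

theorem UniformlyTight.sum {ι : Type*} (s : Finset ι) {f : ι → ℕ → Ω → ℝ}
    (hf : ∀ i ∈ s, UniformlyTight μ (f i)) :
    UniformlyTight μ fun n ω => ∑ i ∈ s, f i n ω := by
  classical
  induction s using Finset.induction_on with
  | empty => exact fun δ hδ => ⟨1, one_pos, by norm_num⟩
  | insert a s ha ih =>
    intro δ hδ
    obtain ⟨M₁, hM₁, h₁⟩ := hf a (Finset.mem_insert_self a s) (δ / 2) (ENNReal.half_pos hδ.ne')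
    obtain ⟨M₂, hM₂, h₂⟩ := ih (fun i hi => hf i (Finset.mem_insert_of_mem hi)) (δ / 2)
      (ENNReal.half_pos hδ.ne')
    refine ⟨M₁ + M₂, by positivity, ?_⟩
    filter_upwards [h₁, h₂] with n h1 h2
    rw [← ENNReal.add_halves δ]
    refine (measure_mono fun ω hω => ?_).trans
      ((measure_union_le _ _).trans (add_le_add h1 h2))
    by_contra hcon
    have h3 : f a n ω < M₁ := not_le.1 fun h => hcon (Or.inl h)
    have h4 : ∑ i ∈ s, f i n ω < M₂ := not_le.1 fun h => hcon (Or.inr h)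
    have h5 : M₁ + M₂ ≤ ∑ i ∈ insert a s, f i n ω := hω
    rw [Finset.sum_insert ha] at h5
    linarith

theorem UniformlyTight.const_mul {f : ℕ → Ω → ℝ} (hf : UniformlyTight μ f) {c : ℝ}
    (hc : 0 ≤ c) : UniformlyTight μ fun n ω => c * f n ω := by
  intro δ hδ
  obtain ⟨M, hM, h⟩ := hf δ hδ
  refine ⟨(c + 1) * M, by positivity, ?_⟩
  filter_upwards [h] with n hn
  refine (measure_mono fun ω (hω : (c + 1) * M ≤ c * f n ω) => ?_).trans hn
  change M ≤ f n ω
  by_contra hcon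
  nlinarith

theorem UniformlyTight.mono {f g : ℕ → Ω → ℝ} (hg : UniformlyTight μ g)
    (h : ∀ n ω, f n ω ≤ g n ω) : UniformlyTight μ f := by
  intro δ hδ
  obtain ⟨M, hM, hM'⟩ := hg δ hδ
  refine ⟨M, hM, ?_⟩
  filter_upwards [hM'] with n hn
  exact (measure_mono fun ω (hω : M ≤ f n ω) => hω.trans (h n ω)).trans hn

theorem VanishesInProbability.tendstoInMeasure {E : Type*} [SeminormedAddCommGroup E]
    {Y : ℕ → Ω → E} (h : VanishesInProbability μ fun n ω => ‖Y n ω‖) :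
    TendstoInMeasure μ Y atTop 0 := by
  rw [tendstoInMeasure_iff_norm]
  intro ε hε
  simpa using h ε hε

/-- If `y - Y` is bounded by a vanishing term plus a vanishing multiple of `y`, and `Y` is tight,
then `y - Y` vanishes. -/
theorem vanishesInProbability_norm_sub_of_le {E : Type*} [SeminormedAddCommGroup E]
    {y Y : ℕ → Ω → E} {b η : ℕ → Ω → ℝ} (hη0 : ∀ n ω, 0 ≤ η n ω)
    (hb : VanishesInProbability μ b) (hη : VanishesInProbability μ η)
    (hY : UniformlyTight μ fun n ω => ‖Y n ω‖)
    (h : ∀ᶠ n in atTop, ∀ᵐ ω ∂μ, ‖y n ω - Y n ω‖ ≤ b n ω + η n ω * ‖y n ω‖) :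
    VanishesInProbability μ fun n ω => ‖y n ω - Y n ω‖ := by
  -- Where `η < 1/2`, the inequality `‖y‖ ≤ ‖y - Y‖ + ‖Y‖` lets half of `‖y - Y‖` be absorbed on the
  -- left; this costs the factors 2.
  have hmain := (hb.const_mul (c := 2) (by norm_num)).add
    ((hη.mul_uniformlyTight hη0 hY).const_mul (c := 2) (by norm_num))
  intro ε hε
  have hlim := (hmain ε hε).add (hη (1 / 2) (by norm_num))
  rw [add_zero] at hlim
  refine tendsto_of_tendsto_of_tendsto_of_le_of_le' tendsto_const_nhds hlim
    (Eventually.of_forall fun _ => zero_le) ?_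
  filter_upwards [h] with n hn
  refine (measure_mono_ae ?_).trans (measure_union_le _ _)
  filter_upwards [hn] with ω hω (hε' : ε ≤ ‖y n ω - Y n ω‖)
  by_contra hcon
  have h3 : 2 * b n ω + 2 * (η n ω * ‖Y n ω‖) < ε := not_le.1 fun h => hcon (Or.inl h)
  have h4 : η n ω < 1 / 2 := not_le.1 fun h => hcon (Or.inr h)
  have h5 : ‖y n ω‖ ≤ ‖y n ω - Y n ω‖ + ‖Y n ω‖ := norm_le_norm_sub_add _ _
  nlinarith [mul_le_mul_of_nonneg_left h5 (hη0 n ω), hη0 n ω, norm_nonneg (y n ω - Y n ω)]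

end VanishesInProbability

/-! ### Chebyshev bounds for row sums of i.i.d. arrays -/

section Averages

variable {Ω α : Type*} [MeasurableSpace Ω] [MeasurableSpace α] {μ : Measure Ω} {J : ℕ}

/-- Chebyshev's inequality for a sum of `n` independent copies of a bounded random variable. -/
theorem measure_le_abs_sum_sub_le {ν : Measure α} [IsProbabilityMeasure ν] {n : ℕ}
    {s : Ω → Fin n → α} (hs : HasLaw s (Measure.pi fun _ => ν) μ) {ψ : α → ℝ}
    (hψ : Measurable ψ) {C : ℝ} (hC : ∀ᵐ a ∂ν, |ψ a| ≤ C) {ε : ℝ} (hε : 0 < ε) :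
    μ {ω | ε ≤ |∑ i, ψ (s ω i) - n * ∫ a, ψ a ∂ν|} ≤ ENNReal.ofReal (n * C ^ 2 / ε ^ 2) := by
  have hL2 : MemLp ψ 2 ν := MemLp.of_bound hψ.aestronglyMeasurable C hC
  have hmp (i : Fin n) : MeasurePreserving (Function.eval i) (Measure.pi fun _ : Fin n => ν) ν :=
    measurePreserving_eval _ i
  have hL2i (i : Fin n) : MemLp (fun x : Fin n → α => ψ (x i)) 2 (Measure.pi fun _ => ν) :=
    hL2.comp_measurePreserving (hmp i)
  have hmem : MemLp (∑ i, fun x : Fin n → α => ψ (x i)) 2 (Measure.pi fun _ => ν) :=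
    memLp_finsetSum' _ fun i _ => hL2i i
  have hE : ∫ x, (∑ i, fun x : Fin n → α => ψ (x i)) x ∂(Measure.pi fun _ => ν)
      = n * ∫ a, ψ a ∂ν := by
    simp only [Finset.sum_apply]
    rw [integral_finsetSum _ fun i _ => (hL2i i).integrable (by norm_num)]
    simp [integral_comp_eval (μ := fun _ : Fin n => ν) hψ.aestronglyMeasurable]
  have hV : Var[∑ i, fun x : Fin n → α => ψ (x i); Measure.pi fun _ => ν] ≤ n * C ^ 2 := by
    rw [variance_sum_pi fun _ => hL2]
    -- A variable in an interval has variance at most the squared half-length, here `C`.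
    have h1 : Var[ψ; ν] ≤ C ^ 2 := by
      refine (variance_le_sq_of_bounded (a := -C) (b := C) ?_ hψ.aemeasurable).trans (le_of_eq ?_)
      · filter_upwards [hC] with a ha using abs_le.1 ha
      · ring
    simpa using mul_le_mul_of_nonneg_left h1 (Nat.cast_nonneg n)
  have hmeas : MeasurableSet {x : Fin n → α | ε ≤ |∑ i, ψ (x i) - n * ∫ a, ψ a ∂ν|} := by
    refine measurableSet_le measurable_const ?_
    fun_prop
  rw [hs.measure_eq (p := fun x : Fin n → α => ε ≤ |∑ i, ψ (x i) - n * ∫ a, ψ a ∂ν|) hmeas]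
  have h := meas_ge_le_variance_div_sq hmem hε
  rw [hE] at h
  simp only [Finset.sum_apply] at h
  exact h.trans (ENNReal.ofReal_le_ofReal (by gcongr))

/-- Weak law of large numbers for bounded triangular arrays, with normalization `c`. -/
theorem vanishesInProbability_abs_sum_sub {ν : ℕ → Measure α} [∀ n, IsProbabilityMeasure (ν n)]
    {s : (n : ℕ) → Ω → Fin n → α} (hs : ∀ n, HasLaw (s n) (Measure.pi fun _ => ν n) μ)
    {ψ : α → ℝ} (hψ : Measurable ψ) {C : ℕ → ℝ} (hC : ∀ n, ∀ᵐ a ∂(ν n), |ψ a| ≤ C n) {c : ℕ → ℝ}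
    (hc : Tendsto (fun n => n * (c n * C n) ^ 2) atTop (𝓝 0)) :
    VanishesInProbability μ fun n ω => |c n * (∑ i, ψ (s n ω i) - n * ∫ a, ψ a ∂(ν n))| := by
  intro ε hε
  have hlim := ENNReal.tendsto_ofReal (hc.div_const (ε ^ 2))
  rw [zero_div, ENNReal.ofReal_zero] at hlim
  refine tendsto_of_tendsto_of_tendsto_of_le_of_le tendsto_const_nhds hlim (fun _ => zero_le)
    fun n => ?_
  rcases eq_or_ne (c n) 0 with h0 | h0
  · simp [h0, not_le.2 hε]
  have hpos : 0 < |c n| := abs_pos.2 h0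
  refine (measure_mono fun ω (hω : ε ≤ |_ * _|) => ?_).trans
    ((measure_le_abs_sum_sub_le (hs n) hψ (hC n) (div_pos hε hpos)).trans (le_of_eq ?_))
  · rw [abs_mul] at hω
    change ε / |c n| ≤ _
    rw [div_le_iff₀ hpos]
    linarith
  · congr 1
    rw [div_pow, sq_abs]
    field_simp

theorem uniformlyTight_abs_inv_sqrt_mul_sum_sub {ν : Measure α} [IsProbabilityMeasure ν]
    {s : (n : ℕ) → Ω → Fin n → α} (hs : ∀ n, HasLaw (s n) (Measure.pi fun _ => ν) μ)
    {ψ : α → ℝ} (hψ : Measurable ψ) {C : ℝ} (hC : ∀ᵐ a ∂ν, |ψ a| ≤ C) :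
    UniformlyTight μ fun n ω => |(√(n : ℝ))⁻¹ * (∑ i, ψ (s n ω i) - n * ∫ a, ψ a ∂ν)| := by
  intro δ hδ
  have hlim : Tendsto (fun M : ℝ => ENNReal.ofReal (C ^ 2 / M ^ 2)) atTop (𝓝 0) := by
    have h := ENNReal.tendsto_ofReal
      ((tendsto_pow_atTop (α := ℝ) two_ne_zero).const_div_atTop (C ^ 2))
    rwa [ENNReal.ofReal_zero] at h
  obtain ⟨M, hMδ, hM⟩ := ((ENNReal.tendsto_nhds_zero.1 hlim δ hδ).and (eventually_gt_atTop 0)).exists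
  refine ⟨M, hM, ?_⟩
  filter_upwards [eventually_gt_atTop 0] with n hn
  have hpos : 0 < √(n : ℝ) := Real.sqrt_pos.2 (by exact_mod_cast hn)
  refine le_trans ((measure_mono fun ω (hω : M ≤ |_ * _|) => ?_).trans
    (measure_le_abs_sum_sub_le (hs n) hψ hC (mul_pos hpos hM))) (le_trans (le_of_eq ?_) hMδ)
  · rw [abs_mul, abs_of_pos (inv_pos.2 hpos), le_inv_mul_iff₀ hpos] at hω
    exact hω
  · congr 1
    rw [mul_pow, Real.sq_sqrt (Nat.cast_nonneg n)]
    have : (n : ℝ) ≠ 0 := by exact_mod_cast hn.ne'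
    field_simp

theorem norm_le_sum_abs (v : Price J) : ‖v‖ ≤ ∑ j, |v j| := by
  conv_lhs => rw [← (EuclideanSpace.basisFun (Fin J) ℝ).sum_repr v]
  refine (norm_sum_le _ _).trans (le_of_eq ?_)
  simp [norm_smul]

theorem abs_apply_le_norm (v : Price J) (j : Fin J) : |v j| ≤ ‖v‖ := by
  simpa using PiLp.norm_apply_le v j

theorem integral_apply {ν : Measure α} {φ : α → Price J} (hφ : Integrable φ ν) (j : Fin J) :
    (∫ a, φ a ∂ν) j = ∫ a, φ a j ∂ν :=
  ((EuclideanSpace.proj j : Price J →L[ℝ] ℝ).integral_comp_comm hφ).symm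

theorem vanishesInProbability_norm_sum_sub {ν : ℕ → Measure α} [∀ n, IsProbabilityMeasure (ν n)]
    {s : (n : ℕ) → Ω → Fin n → α} (hs : ∀ n, HasLaw (s n) (Measure.pi fun _ => ν n) μ)
    {φ : α → Price J} (hφ : Measurable φ) {C : ℕ → ℝ} (hC : ∀ n, ∀ᵐ a ∂(ν n), ‖φ a‖ ≤ C n)
    {c : ℕ → ℝ} (hc : Tendsto (fun n => n * (c n * C n) ^ 2) atTop (𝓝 0)) :
    VanishesInProbability μ fun n ω =>
      ‖c n • (∑ i, φ (s n ω i) - (n : ℝ) • ∫ a, φ a ∂(ν n))‖ := by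
  have h := VanishesInProbability.sum Finset.univ fun j (_ : j ∈ Finset.univ) =>
    vanishesInProbability_abs_sum_sub hs (ψ := fun a => φ a j) (by fun_prop)
      (fun n => (hC n).mono fun a ha => (abs_apply_le_norm _ j).trans ha) hc
  refine h.mono (Eventually.of_forall fun n => ae_of_all _ fun ω => ?_)
  refine (norm_le_sum_abs _).trans (le_of_eq (Finset.sum_congr rfl fun j _ => ?_))
  have hint : Integrable φ (ν n) := Integrable.of_bound hφ.aestronglyMeasurable (C n) (hC n)
  simp [integral_apply hint]

theorem uniformlyTight_norm_inv_sqrt_smul_sum {ν : Measure α} [IsProbabilityMeasure ν]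
    {s : (n : ℕ) → Ω → Fin n → α} (hs : ∀ n, HasLaw (s n) (Measure.pi fun _ => ν) μ)
    {φ : α → Price J} (hφ : Measurable φ) {C : ℝ} (hC : ∀ᵐ a ∂ν, ‖φ a‖ ≤ C)
    (h0 : ∫ a, φ a ∂ν = 0) :
    UniformlyTight μ fun n ω => ‖(√(n : ℝ))⁻¹ • ∑ i, φ (s n ω i)‖ := by
  have h := UniformlyTight.sum Finset.univ fun j (_ : j ∈ Finset.univ) =>
    uniformlyTight_abs_inv_sqrt_mul_sum_sub hs (ψ := fun a => φ a j) (by fun_prop)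
      (hC.mono fun a ha => (abs_apply_le_norm _ j).trans ha)
  refine h.mono fun n ω => ?_
  refine (norm_le_sum_abs _).trans (le_of_eq (Finset.sum_congr rfl fun j _ => ?_))
  have hint : Integrable φ ν := Integrable.of_bound hφ.aestronglyMeasurable C hC
  simp [← integral_apply hint, h0]

end Averages

/-! ### Central limit theorem through characteristic functions -/

section CentralLimit

variable {Ω α : Type*} [MeasurableSpace Ω] [MeasurableSpace α] {μ : Measure Ω} {J : ℕ}

theorem tendsto_charFun_inv_sqrt_pow {ν : Measure α} [IsProbabilityMeasure ν] {X : α → ℝ}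
    (hX : MemLp X 2 ν) (h0 : ∫ a, X a ∂ν = 0) :
    Tendsto (fun n : ℕ => charFun (ν.map X) (√(n : ℝ))⁻¹ ^ n) atTop
      (𝓝 (Complex.exp (-((∫ a, X a ^ 2 ∂ν : ℝ) : ℂ) / 2))) := by
  have hm : AEMeasurable X ν := hX.aestronglyMeasurable.aemeasurable
  -- Positive variance is normalized to one; zero variance cannot be, but then `X` vanishes almost
  -- everywhere.
  rcases (integral_nonneg fun a => sq_nonneg (X a) : 0 ≤ ∫ a, X a ^ 2 ∂ν).eq_or_lt' with hv | hv
  · have hz : X =ᵐ[ν] fun _ => 0 := by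
      have := (integral_eq_zero_iff_of_nonneg (fun a => sq_nonneg (X a)) hX.integrable_sq).1 hv
      filter_upwards [this] with a ha
      simpa using ha
    rw [hv, Measure.map_congr hz]
    simp
  · set v := ∫ a, X a ^ 2 ∂ν with hv_def
    have hs : √v ≠ 0 := (Real.sqrt_pos.2 hv).ne'
    have h := tendsto_charFun_inv_sqrt_mul_pow (P := ν) (X := fun a => (√v)⁻¹ * X a)
      (hm.const_mul _) (by rw [integral_const_mul, h0, mul_zero])
      (by
        simp only [Pi.pow_apply, mul_pow]
        rw [integral_const_mul, ← hv_def, inv_pow, Real.sq_sqrt hv.le, inv_mul_cancel₀ hv.ne'])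
      (√v)
    have he : -((√v : ℝ) : ℂ) ^ 2 / 2 = -(v : ℂ) / 2 := by
      rw [← Complex.ofReal_pow, Real.sq_sqrt hv.le]
    rw [he] at h
    refine h.congr fun n => ?_
    rw [charFun_map_mul_comp hm]
    congr 2
    field_simp

/-- Independence factorizes the characteristic function, and its value at the vector `t` involves
only the scalar projections onto `t`. This reduces the vector limit to the scalar one. -/
theorem charFun_map_inv_sqrt_smul_sum {ν : Measure α} [IsProbabilityMeasure ν] {n : ℕ}
    {s : Ω → Fin n → α} (hs : HasLaw s (Measure.pi fun _ => ν) μ) {φ : α → Price J}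
    (hφ : Measurable φ) (t : Price J) :
    charFun (μ.map fun ω => (√(n : ℝ))⁻¹ • ∑ i, φ (s ω i)) t =
      charFun (ν.map fun a => inner ℝ (φ a) t) (√(n : ℝ))⁻¹ ^ n := by
  have hφn : Measurable fun x : Fin n → α => (√(n : ℝ))⁻¹ • ∑ i, φ (x i) := by fun_prop
  have hmap : μ.map (fun ω => (√(n : ℝ))⁻¹ • ∑ i, φ (s ω i)) =
      (Measure.pi fun _ => ν).map fun x : Fin n → α => (√(n : ℝ))⁻¹ • ∑ i, φ (x i) := by
    rw [← hs.map_eq, AEMeasurable.map_map_of_aemeasurable hφn.aemeasurable hs.aemeasurable]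
    rfl
  have hin : Measurable fun a => inner ℝ (φ a) t := by fun_prop
  rw [hmap, charFun_apply, integral_map hφn.aemeasurable (by fun_prop), charFun_apply_real,
    integral_map hin.aemeasurable (by fun_prop)]
  have h := integral_fintype_prod_eq_pow (ι := Fin n) (μ := ν) (𝕜 := ℂ) fun a =>
    Complex.exp (((√(n : ℝ))⁻¹ : ℝ) * ((inner ℝ (φ a) t : ℝ) : ℂ) * Complex.I)
  rw [Fintype.card_fin] at h
  rw [← h]
  refine integral_congr_ae (ae_of_all _ fun x => ?_)
  simp only [real_inner_smul_left, sum_inner]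
  rw [← Complex.exp_sum]
  congr 1
  push_cast
  rw [Finset.mul_sum, Finset.sum_mul]

/-- Expand the square of the inner product. The identity gives both positive semidefiniteness of the
matrix and the match with the Gaussian exponent. -/
theorem dotProduct_secondMoment_mulVec {ν : Measure α} {φ : α → Price J} (hφ : MemLp φ 2 ν)
    (t : Price J) :
    (t.ofLp ⬝ᵥ (Matrix.of fun j k => ∫ a, φ a j * φ a k ∂ν).mulVec t.ofLp) =
      ∫ a, inner ℝ (φ a) t ^ 2 ∂ν := by
  have hc (j : Fin J) : MemLp (fun a => φ a j) 2 ν :=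
    (EuclideanSpace.proj j : Price J →L[ℝ] ℝ).comp_memLp' hφ
  have hint (j k : Fin J) : Integrable (fun a => t j * (φ a j * φ a k * t k)) ν :=
    (((hc j).integrable_mul (hc k)).mul_const _).const_mul _
  have hsq (a : α) : inner ℝ (φ a) t ^ 2 = ∑ j, ∑ k, t j * (φ a j * φ a k * t k) := by
    rw [PiLp.inner_apply, sq, Finset.sum_mul_sum]
    refine Finset.sum_congr rfl fun j _ => Finset.sum_congr rfl fun k _ => ?_
    simp
    ring
  simp only [hsq]
  rw [integral_finsetSum _ fun j _ => integrable_finsetSum _ fun k _ => hint j k]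
  simp only [dotProduct, Matrix.mulVec, Matrix.of_apply, Finset.mul_sum]
  refine Finset.sum_congr rfl fun j _ => ?_
  rw [integral_finsetSum _ fun k _ => hint j k]
  refine Finset.sum_congr rfl fun k _ => ?_
  rw [integral_const_mul, integral_mul_const]

/-- The second moment matrix of a square-integrable random vector is positive semidefinite. -/
theorem posSemidef_secondMoment {ν : Measure α} {φ : α → Price J} (hφ : MemLp φ 2 ν) :
    (Matrix.of fun j k => ∫ a, φ a j * φ a k ∂ν).PosSemidef := by
  refine Matrix.PosSemidef.of_dotProduct_mulVec_nonneg ?_ fun t => ?_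
  · ext j k
    simp [mul_comm]
  · have h := dotProduct_secondMoment_mulVec hφ (WithLp.toLp 2 t)
    simp only [star_trivial]
    rw [h]
    exact integral_nonneg fun a => sq_nonneg _

/-- The multivariate central limit theorem for the row sums of an array whose rows are i.i.d. with
a common centered law. -/
theorem tendstoInDistribution_inv_sqrt_smul_sum [IsProbabilityMeasure μ] {ν : Measure α}
    [IsProbabilityMeasure ν] {s : (n : ℕ) → Ω → Fin n → α}
    (hs : ∀ n, HasLaw (s n) (Measure.pi fun _ => ν) μ) {φ : α → Price J} (hφ : Measurable φ)
    (hL2 : MemLp φ 2 ν) (h0 : ∫ a, φ a ∂ν = 0) :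
    TendstoInDistribution (fun (n : ℕ) ω => (√(n : ℝ))⁻¹ • ∑ i, φ (s n ω i)) atTop id
      (fun _ => μ) (multivariateGaussian 0 (Matrix.of fun j k => ∫ a, φ a j * φ a k ∂ν)) where
  forall_aemeasurable n := by
    have hφn : Measurable fun x : Fin n → α => (√(n : ℝ))⁻¹ • ∑ i, φ (x i) := by fun_prop
    exact hφn.comp_aemeasurable (hs n).aemeasurable
  tendsto := by
    refine ProbabilityMeasure.tendsto_iff_tendsto_charFun.2 fun t => ?_
    have hin : MemLp (fun a => inner ℝ (φ a) t) 2 ν := by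
      simpa [real_inner_comm, Function.comp_def] using (innerSL ℝ t).comp_memLp' hL2
    have hzero : ∫ a, inner ℝ (φ a) t ∂ν = 0 := by
      simp only [fun a => real_inner_comm t (φ a)]
      rw [integral_inner (hL2.integrable (by norm_num)), h0, inner_zero_right]
    have h := tendsto_charFun_inv_sqrt_pow hin hzero
    simp only [ProbabilityMeasure.coe_mk, Measure.map_id]
    rw [charFun_multivariateGaussian (posSemidef_secondMoment hL2),
      dotProduct_secondMoment_mulVec hL2]
    simp only [charFun_map_inv_sqrt_smul_sum (hs _) hφ]
    simpa [neg_div] using h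

end CentralLimit

/-! ### Deterministic linearization of the clearing equation -/

section Expansion

variable {J : ℕ}

theorem norm_inv_smul_sum_le {E : Type*} [SeminormedAddCommGroup E] [NormedSpace ℝ E] {n : ℕ}
    {v : Fin n → E} {b : ℝ} (hb : 0 ≤ b) (hv : ∀ i, ‖v i‖ ≤ b) :
    ‖(n : ℝ)⁻¹ • ∑ i, v i‖ ≤ b := by
  have h : ‖∑ i, v i‖ ≤ n * b := by
    simpa using norm_sum_le_of_le Finset.univ fun i _ => hv i
  rw [norm_smul, norm_inv, Real.norm_natCast]
  rcases n.eq_zero_or_pos with rfl | hn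
  · simpa using hb
  · rw [inv_mul_le_iff₀ (by exact_mod_cast hn)]
    exact h

theorem inv_sqrt_eq_sqrt_mul_inv {n : ℕ} (hn : 0 < n) :
    (√(n : ℝ))⁻¹ = √(n : ℝ) * (n : ℝ)⁻¹ := by
  have h : (n : ℝ) = √(n : ℝ) * √(n : ℝ) := (Real.mul_self_sqrt (Nat.cast_nonneg n)).symm
  have hpos : √(n : ℝ) ≠ 0 := (Real.sqrt_pos.2 (by exact_mod_cast hn)).ne'
  rw [eq_comm]
  nth_rewrite 2 [h]
  field_simp

/-- Separates the operator error from the vector: only the finitely many basis directions need a law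
of large numbers, so `v` may itself be random. -/
theorem norm_inv_smul_sum_sub_apply_le {n : ℕ} (d : Fin n → Price J →L[ℝ] Price J)
    (A : Price J →L[ℝ] Price J) (v : Price J) :
    ‖(n : ℝ)⁻¹ • (∑ i, d i v - (n : ℝ) • A v)‖ ≤
      (∑ k, ‖(n : ℝ)⁻¹ • (∑ i, d i (EuclideanSpace.single k 1)
        - (n : ℝ) • A (EuclideanSpace.single k 1))‖) * ‖v‖ := by
  have h := sum_smul_map_single ((n : ℝ)⁻¹ • (∑ i, d i - (n : ℝ) • A)) v
  have he (u : Price J) : ((n : ℝ)⁻¹ • (∑ i, d i - (n : ℝ) • A)) u =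
      (n : ℝ)⁻¹ • (∑ i, d i u - (n : ℝ) • A u) := by
    simp
  simp only [he] at h
  rw [h, Finset.sum_mul]
  refine norm_sum_le_of_le _ fun k _ => ?_
  rw [norm_smul, mul_comm, Real.norm_eq_abs]
  exact mul_le_mul_of_nonneg_left (abs_apply_le_norm v k) (norm_nonneg _)

/-- Linearization of an estimating equation: if `z₁ i = z₀ i + d i (δ + U i)` up to a quadratic
remainder and the `d i` average to `A` with inverse `G`, then `√n δ` is `-G` times the normalized
sum of the `z₀ i`, up to explicit error terms. -/
theorem norm_sqrt_smul_sub_le {n : ℕ} (hn : 0 < n) {G A : Price J →L[ℝ] Price J}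
    (hGA : ∀ v, G (A v) = v) {d : Fin n → Price J →L[ℝ] Price J} {z₀ z₁ U : Fin n → Price J}
    {δ : Price J} {b C : ℝ} (hC : 0 ≤ C)
    (hR : ∀ i, ‖z₁ i - z₀ i - d i (δ + U i)‖ ≤ C * ‖δ + U i‖ ^ 2) (hU : ∀ i, ‖U i‖ ≤ b) :
    ‖√(n : ℝ) • δ - (√(n : ℝ))⁻¹ • ∑ i, -G (z₀ i)‖ ≤
      ‖G‖ * (√(n : ℝ) * ‖(n : ℝ)⁻¹ • ∑ i, z₁ i‖ + ‖(√(n : ℝ))⁻¹ • ∑ i, d i (U i)‖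
        + 2 * C * (√(n : ℝ) * b ^ 2)) +
      ‖G‖ * ((∑ k, ‖(n : ℝ)⁻¹ • (∑ i, d i (EuclideanSpace.single k 1)
        - (n : ℝ) • A (EuclideanSpace.single k 1))‖) + 2 * C * ‖δ‖) * ‖√(n : ℝ) • δ‖ := by
  have hn0 : (n : ℝ) ≠ 0 := by exact_mod_cast hn.ne'
  set r : ℝ := √(n : ℝ) with hr
  have hr0 : 0 ≤ r := Real.sqrt_nonneg _
  have hri : r⁻¹ = r * (n : ℝ)⁻¹ := inv_sqrt_eq_sqrt_mul_inv hn
  set R : Fin n → Price J := fun i => z₁ i - z₀ i - d i (δ + U i) with hRdef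
  have hRle : ‖(n : ℝ)⁻¹ • ∑ i, R i‖ ≤ 2 * C * (‖δ‖ ^ 2 + b ^ 2) := by
    refine norm_inv_smul_sum_le (by positivity) fun i => (hR i).trans ?_
    have h1 : ‖δ + U i‖ ≤ ‖δ‖ + b := (norm_add_le _ _).trans (add_le_add_right (hU i) _)
    have h2 : ‖δ + U i‖ ^ 2 ≤ (‖δ‖ + b) ^ 2 := pow_le_pow_left₀ (norm_nonneg _) h1 2
    have h3 : (‖δ‖ + b) ^ 2 ≤ 2 * (‖δ‖ ^ 2 + b ^ 2) := add_sq_le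
    nlinarith [mul_le_mul_of_nonneg_left (h2.trans h3) hC]
  have hsum : ∑ i, z₁ i = ∑ i, z₀ i + ∑ i, d i δ + ∑ i, d i (U i) + ∑ i, R i := by
    simp only [hRdef, map_add, Finset.sum_sub_distrib, Finset.sum_add_distrib]
    abel
  have hE := norm_inv_smul_sum_sub_apply_le d A (r • δ)
  set κ := ∑ k, ‖(n : ℝ)⁻¹ • (∑ i, d i (EuclideanSpace.single k 1)
        - (n : ℝ) • A (EuclideanSpace.single k 1))‖
  -- Exact identity: `G` inverts `A`, and `hsum` expresses the `z₀` sum by the clearing error, the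
  -- derivative terms and the remainder.
  have hid : r • δ - r⁻¹ • ∑ i, -G (z₀ i) =
      G (r • ((n : ℝ)⁻¹ • ∑ i, z₁ i) - (n : ℝ)⁻¹ • (∑ i, d i (r • δ) - (n : ℝ) • A (r • δ))
        - r⁻¹ • ∑ i, d i (U i) - r • ((n : ℝ)⁻¹ • ∑ i, R i)) := by
    have h1 : r • δ - r⁻¹ • ∑ i, -G (z₀ i) = G (A (r • δ) + r⁻¹ • ∑ i, z₀ i) := by
      rw [map_add, hGA, map_smul, map_sum, Finset.sum_neg_distrib, smul_neg, sub_neg_eq_add]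
    rw [h1, hsum, hri]
    congr 1
    simp only [map_smul, smul_sub, smul_add, ← Finset.smul_sum, smul_smul,
      mul_comm (n : ℝ)⁻¹ r]
    rw [← mul_assoc, inv_mul_cancel₀ hn0, one_mul]
    abel
  rw [hid]
  refine (G.le_opNorm _).trans ?_
  rw [mul_assoc ‖G‖ (κ + _), ← mul_add]
  refine mul_le_mul_of_nonneg_left ?_ (norm_nonneg G)
  refine (norm_sub_le _ _).trans ((add_le_add_left (norm_sub_le _ _) _).trans
    ((add_le_add_left (add_le_add_left (norm_sub_le _ _) _) _).trans ?_))
  rw [norm_smul r ((n : ℝ)⁻¹ • ∑ i, z₁ i), norm_smul r ((n : ℝ)⁻¹ • ∑ i, R i),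
    Real.norm_of_nonneg hr0]
  -- The remainder `r * ‖δ‖ ^ 2` is read as `‖δ‖ * ‖r • δ‖`, a multiple of the unknown that vanishes
  -- by consistency.
  have hyn : ‖r • δ‖ = r * ‖δ‖ := by rw [norm_smul, Real.norm_of_nonneg hr0]
  have h4 := mul_le_mul_of_nonneg_left hRle hr0
  rw [hyn] at hE ⊢
  nlinarith [h4, hE]

end Expansion

/-! ### The sandwich matrix as a second moment -/

section Covariance

variable {J : ℕ} {𝒢 : Type*} [MeasurableSpace 𝒢] {Θ : Measure 𝒢} [IsProbabilityMeasure Θ]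
  {D S : 𝒢 → Bool → Price J → Price J} {π : unitInterval} {l u : Price J} {K : Set (Price J)}

theorem isUnit_of_rank_eq {A : Matrix (Fin J) (Fin J) ℝ} (h : A.rank = J) : IsUnit A := by
  rw [← Matrix.mulVec_surjective_iff_isUnit]
  have h1 : LinearMap.range A.mulVecLin = ⊤ :=
    Submodule.eq_top_of_finrank_eq (by simpa [Matrix.rank] using h)
  exact LinearMap.range_eq_top.1 h1

/-- Puts the sandwich in the form in which the central limit theorem for `-H⁻¹ Z` delivers its
covariance; the two signs cancel. -/
theorem asympCov_eq (hZ : IsRegular (excess D S) K) {p : Price J} (hp : p ∈ K) :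
    asympCov Θ D S π l u p = Matrix.of fun j k => ∫ a,
      (-Matrix.toEuclideanCLM (𝕜 := ℝ) (jacobian Θ D S π l u p)⁻¹ (excess D S a.1 a.2 p)) j *
      (-Matrix.toEuclideanCLM (𝕜 := ℝ) (jacobian Θ D S π l u p)⁻¹ (excess D S a.1 a.2 p)) k
        ∂(agentLaw Θ π) := by
  obtain ⟨C, hC⟩ := hZ.bounded
  have hL2 : MemLp (fun a : 𝒢 × Bool => excess D S a.1 a.2 p) 2 (agentLaw Θ π) := by
    refine MemLp.of_bound (hZ.measurable_uncurry hp).aestronglyMeasurable C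
      (ae_of_all _ fun a => ?_)
    rw [← norm_iteratedFDerivWithin_zero (𝕜 := ℝ) (s := K)]
    exact hC a.1 a.2 0 (by norm_num) p hp
  have hc (j : Fin J) : MemLp (fun a : 𝒢 × Bool => excess D S a.1 a.2 p j) 2 (agentLaw Θ π) :=
    (EuclideanSpace.proj j : Price J →L[ℝ] ℝ).comp_memLp' hL2
  set G := (jacobian Θ D S π l u p)⁻¹ with hG
  have hint (j k m i : Fin J) : Integrable (fun a : 𝒢 × Bool =>
      G j m * (excess D S a.1 a.2 p m * excess D S a.1 a.2 p i * G k i)) (agentLaw Θ π) :=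
    (((hc m).integrable_mul (hc i)).mul_const _).const_mul _
  ext j k
  have hprod (a : 𝒢 × Bool) :
      (-Matrix.toEuclideanCLM (𝕜 := ℝ) G (excess D S a.1 a.2 p)) j *
        (-Matrix.toEuclideanCLM (𝕜 := ℝ) G (excess D S a.1 a.2 p)) k =
      ∑ i, ∑ m, G j m * (excess D S a.1 a.2 p m * excess D S a.1 a.2 p i * G k i) := by
    simp only [PiLp.neg_apply, neg_mul_neg, Matrix.ofLp_toEuclideanCLM, Matrix.mulVec, dotProduct,
      Finset.sum_mul_sum]
    rw [Finset.sum_comm]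
    refine Finset.sum_congr rfl fun i _ => Finset.sum_congr rfl fun m _ => by ring
  simp only [hprod, Matrix.of_apply]
  rw [integral_finsetSum _ fun i _ => integrable_finsetSum _ fun m _ => hint j k m i]
  simp only [asympCov, ← hG, Matrix.mul_apply, Matrix.transpose_apply, secondMoment,
    Matrix.of_apply, Finset.sum_mul]
  refine Finset.sum_congr rfl fun i _ => ?_
  rw [integral_finsetSum _ fun m _ => hint j k m i]
  refine Finset.sum_congr rfl fun m _ => ?_
  rw [integral_const_mul, integral_mul_const, mul_assoc]

end Covariance

/-! ### Consistency and asymptotic normality for general small perturbations -/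

section Asymptotics

variable {J : ℕ} {𝒢 Ω : Type*} [MeasurableSpace 𝒢] [MeasurableSpace Ω] {μ : Measure Ω}
  {Θ : Measure 𝒢} [IsProbabilityMeasure Θ]
  {D S : 𝒢 → Bool → Price J → Price J} {π : unitInterval} {l u : Price J} {B : ℝ}
  {pstar : Price J} {X : (n : ℕ) → Ω → Fin n → 𝒢} {W : (n : ℕ) → Ω → Fin n → Bool}
  {U : (n : ℕ) → Ω → Fin n → Price J} {P : ℕ → Ω → Price J} {h a : ℕ → ℝ}

theorem norm_le_mul_of_abs_le {v : Price J} {b : ℝ} (hv : ∀ j, |v j| ≤ b) : ‖v‖ ≤ J * b := by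
  refine (norm_le_sum_abs v).trans ((Finset.sum_le_sum fun j _ => hv j).trans ?_)
  simp

theorem tendsto_natCast_mul_inv_mul_sq (C : ℝ) :
    Tendsto (fun n : ℕ => (n : ℝ) * ((n : ℝ)⁻¹ * C) ^ 2) atTop (𝓝 0) := by
  have h := (tendsto_natCast_atTop_atTop (R := ℝ)).inv_tendsto_atTop.mul_const (C ^ 2)
  rw [zero_mul] at h
  refine h.congr' ?_
  filter_upwards [eventually_gt_atTop 0] with n hn
  have : (n : ℝ) ≠ 0 := by exact_mod_cast hn.ne'
  simp only [Pi.inv_apply]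
  field_simp

theorem norm_meanExcess_sub_le {C : ℝ} (hD : IsRegular D (box l u B))
    (hS : IsRegular S (box l u B)) (hZ : IsRegular (excess D S) (box l u B)) (hB : 0 ≤ B)
    (hC : ∀ g w, ∀ p ∈ box l u B, ∀ q ∈ box l u B,
      ‖excess D S g w q - excess D S g w p‖ ≤ C * ‖q - p‖) {p q : Price J}
    (hp : p ∈ box l u 0) (hq : q ∈ box l u 0) :
    ‖meanExcess Θ D S π q - meanExcess Θ D S π p‖ ≤ C * ‖q - p‖ := by
  have hp' := box_mono hB hp
  have hq' := box_mono hB hq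
  have h3 : meanExcess Θ D S π q - meanExcess Θ D S π p =
      ∫ a, (excess D S a.1 a.2 q - excess D S a.1 a.2 p) ∂(agentLaw Θ π) := by
    rw [meanExcess_eq_integral hD hS hZ hp', meanExcess_eq_integral hD hS hZ hq',
      integral_sub (hZ.integrable hq') (hZ.integrable hp')]
  have h4 := norm_integral_le_of_norm_le_const (μ := agentLaw Θ π) (C := C * ‖q - p‖)
    (ae_of_all _ fun a : 𝒢 × Bool => hC a.1 a.2 p hp' q hq')
  rwa [← h3, probReal_univ, mul_one] at h4

/-- Consistency of approximately market-clearing prices. -/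
theorem vanishesInProbability_norm_sub_pstar (hlu : ∀ j, l j < u j) (hB : 0 ≤ B)
    (hD : IsRegular D (box l u B)) (hS : IsRegular S (box l u B))
    (hcon : ∀ p ∈ box l u 0,
      ‖fderivWithin ℝ (fun q => meanExcess Θ D S π q + q) (box l u 0) p‖ < 1)
    (hstar : IsMeanFieldPrice Θ D S π l u pstar)
    (hlaw : ∀ n, HasLaw (fun ω (i : Fin n) => (X n ω i, W n ω i))
      (Measure.pi fun _ : Fin n => agentLaw Θ π) μ)
    (hh : Tendsto h atTop (𝓝 0)) (hhB : ∀ᶠ n in atTop, h n ≤ B)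
    (hU : ∀ n, ∀ᵐ ω ∂μ, ∀ i j, |U n ω i j| ≤ h n) (ha : Tendsto a atTop (𝓝 0))
    (hclear : ∀ᶠ n in atTop, ∀ᵐ ω ∂μ, P n ω ∈ box l u 0 ∧
      ‖avgExcess D S (X n ω) (W n ω) (U n ω) (P n ω)‖ ≤ a n) :
    VanishesInProbability μ fun n ω => ‖P n ω - pstar‖ := by
  have hK := uniqueDiffOn_box hlu hB
  have hZ := isRegular_excess hK hD hS
  obtain ⟨C, hC0, hCb, -, hCl, -⟩ := hZ.exists_bounds hK convex_box
  intro ε hε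
  obtain ⟨ρ, hρ, hsep⟩ := exists_norm_meanExcess_lt_imp hD hS hlu hB hcon hstar hε
  -- Error budget of four quarters of `ρ`: the mesh of the net (used twice, hence `2 * C * r`), the
  -- law of large numbers, the perturbation, and the clearing error. The `+ 1` keeps the denominator
  -- positive.
  set r : ℝ := ρ / (4 * (2 * C + 1)) with hr
  have hr0 : 0 < r := by positivity
  have hrC : 2 * C * r ≤ ρ / 4 := by
    have h1 : (2 * C + 1) * r = ρ / 4 := by
      rw [hr]
      field_simp
    linarith
  -- A finite net stands in for a uniform law of large numbers: the point of the net near the random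
  -- price depends on `ω`, so the deviations at all of its points are summed.
  obtain ⟨t, htS, htfin, hcover⟩ := (isCompact_box (l := l) (u := u) (r := 0)).finite_cover_balls hr0
  have hnet := VanishesInProbability.sum htfin.toFinset fun q hq =>
    vanishesInProbability_norm_sum_sub (c := fun n => (n : ℝ)⁻¹) (C := fun _ => C) hlaw
      (hZ.measurable_uncurry (box_mono hB (htS (htfin.mem_toFinset.1 hq))))
      (fun n => ae_of_all _ fun b => hCb b.1 b.2 q
        (box_mono hB (htS (htfin.mem_toFinset.1 hq)))) (tendsto_natCast_mul_inv_mul_sq C)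
  refine tendsto_of_tendsto_of_tendsto_of_le_of_le' tendsto_const_nhds
    (hnet (ρ / 4) (by positivity)) (Eventually.of_forall fun _ => zero_le) ?_
  have hsmall : Tendsto (fun n => C * (J * h n)) atTop (𝓝 0) := by
    simpa using (hh.const_mul (J : ℝ)).const_mul C
  filter_upwards [hclear, hhB, hsmall.eventually_lt_const (by positivity : 0 < ρ / 4),
    ha.eventually_lt_const (by positivity : 0 < ρ / 4), eventually_gt_atTop 0]
    with n hn hnB hn1 hn2 hnpos
  refine measure_mono_ae ?_
  filter_upwards [hn, hU n] with ω hω hωU (hge : ε ≤ ‖P n ω - pstar‖)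
  by_contra hcontra
  have hlt : ∑ q ∈ htfin.toFinset, ‖(n : ℝ)⁻¹ • (∑ i, excess D S (X n ω i) (W n ω i) q
      - (n : ℝ) • ∫ b, excess D S b.1 b.2 q ∂(agentLaw Θ π))‖ < ρ / 4 := not_le.1 hcontra
  obtain ⟨q, hqt, hq⟩ := Set.mem_iUnion₂.1 (hcover hω.1)
  have hqS := htS hqt
  have hqr : ‖P n ω - q‖ < r := by simpa [dist_eq_norm] using hq
  have hn0 : (n : ℝ) ≠ 0 := by exact_mod_cast hnpos.ne'
  have h1 : ‖(n : ℝ)⁻¹ • (∑ i, excess D S (X n ω i) (W n ω i) q)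
      - meanExcess Θ D S π q‖ < ρ / 4 := by
    refine lt_of_le_of_lt ?_ hlt
    refine le_trans (le_of_eq ?_) (Finset.single_le_sum (f := fun q => ‖(n : ℝ)⁻¹ • (∑ i,
      excess D S (X n ω i) (W n ω i) q - (n : ℝ) • ∫ b, excess D S b.1 b.2 q ∂(agentLaw Θ π))‖)
      (fun _ _ => norm_nonneg _) (htfin.mem_toFinset.2 hqt))
    rw [smul_sub, inv_smul_smul₀ hn0, meanExcess_eq_integral hD hS hZ (box_mono hB hqS)]
  have h2 : ‖(n : ℝ)⁻¹ • (∑ i, excess D S (X n ω i) (W n ω i) q)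
      - avgExcess D S (X n ω) (W n ω) (U n ω) (P n ω)‖ ≤ C * (r + J * h n) := by
    rw [avgExcess, one_div, ← smul_sub, ← Finset.sum_sub_distrib]
    have hh0 : ∀ i : Fin n, ‖q - (P n ω + U n ω i)‖ ≤ r + J * h n := fun i => by
      have : q - (P n ω + U n ω i) = -(P n ω - q) - U n ω i := by abel
      rw [this]
      refine (norm_sub_le _ _).trans (add_le_add ?_ (norm_le_mul_of_abs_le (hωU i)))
      rw [norm_neg]
      exact hqr.le
    have hb0 : 0 ≤ C * (r + J * h n) :=
      mul_nonneg hC0 ((norm_nonneg _).trans (hh0 ⟨0, hnpos⟩))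
    refine norm_inv_smul_sum_le hb0 fun i => ?_
    exact (hCl _ _ _ (add_mem_box hω.1 fun j => (hωU i j).trans hnB) _ (box_mono hB hqS)).trans
      (mul_le_mul_of_nonneg_left (hh0 i) hC0)
  have h3 := norm_meanExcess_sub_le (Θ := Θ) (π := π) hD hS hZ hB hCl hqS hω.1
  have h4 : C * ‖P n ω - q‖ ≤ C * r := mul_le_mul_of_nonneg_left hqr.le hC0
  have h5 : meanExcess Θ D S π (P n ω) =
      (meanExcess Θ D S π (P n ω) - meanExcess Θ D S π q)
      - ((n : ℝ)⁻¹ • (∑ i, excess D S (X n ω i) (W n ω i) q) - meanExcess Θ D S π q)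
      + ((n : ℝ)⁻¹ • (∑ i, excess D S (X n ω i) (W n ω i) q)
        - avgExcess D S (X n ω) (W n ω) (U n ω) (P n ω))
      + avgExcess D S (X n ω) (W n ω) (U n ω) (P n ω) := by abel
  have h6 : ‖meanExcess Θ D S π (P n ω)‖ < ρ := by
    rw [h5]
    refine (norm_add_le _ _).trans_lt ?_
    have h7 := norm_add_le
      ((meanExcess Θ D S π (P n ω) - meanExcess Θ D S π q)
        - ((n : ℝ)⁻¹ • (∑ i, excess D S (X n ω i) (W n ω i) q) - meanExcess Θ D S π q))
      ((n : ℝ)⁻¹ • (∑ i, excess D S (X n ω i) (W n ω i) q)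
        - avgExcess D S (X n ω) (W n ω) (U n ω) (P n ω))
    have h8 := norm_sub_le (meanExcess Θ D S π (P n ω) - meanExcess Θ D S π q)
      ((n : ℝ)⁻¹ • (∑ i, excess D S (X n ω i) (W n ω i) q) - meanExcess Θ D S π q)
    have h9 := hω.2
    linarith
  exact absurd (hsep _ hω.1 h6) (not_lt.2 hge)

theorem measurable_fderivWithin_apply (hZ : IsRegular (excess D S) (box l u B))
    (hlu : ∀ j, l j < u j) (hB : 0 ≤ B) {p : Price J} (hp : p ∈ box l u 0) :
    Measurable fun b : 𝒢 × Bool × Price J =>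
      fderivWithin ℝ (excess D S b.1 b.2.1) (box l u B) p b.2.2 := by
  simp only [fun b : 𝒢 × Bool × Price J => sum_smul_map_single
    (fderivWithin ℝ (excess D S b.1 b.2.1) (box l u B) p) b.2.2]
  have hk (k : Fin J) : Measurable fun b : 𝒢 × Bool × Price J => b.2.2 k := by fun_prop
  refine Finset.measurable_sum _ fun k _ => (hk k).smul ?_
  exact (hZ.measurable_fderivWithin hlu hB hp k).comp
    (measurable_fst.prodMk (measurable_fst.comp measurable_snd))

/-- Asymptotic normality of approximately market-clearing prices, for individual price
perturbations that are small enough and whose first-order effect averages out. -/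
theorem tendstoInDistribution_sqrt_smul_sub_pstar [IsProbabilityMeasure μ]
    (hlu : ∀ j, l j < u j) (hB : 0 ≤ B)
    (hstar : IsMeanFieldPrice Θ D S π l u pstar) (hM : Assumptions Θ D S π l u B pstar)
    (hlaw : ∀ n, HasLaw (fun ω (i : Fin n) => (X n ω i, W n ω i))
      (Measure.pi fun _ : Fin n => agentLaw Θ π) μ)
    (hP : ∀ n, AEMeasurable (P n) μ)
    (hh : Tendsto h atTop (𝓝 0)) (hh2 : Tendsto (fun n : ℕ => √(n : ℝ) * h n ^ 2) atTop (𝓝 0))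
    (hhB : ∀ᶠ n in atTop, h n ≤ B) (hU : ∀ n, ∀ᵐ ω ∂μ, ∀ i j, |U n ω i j| ≤ h n)
    (hT : VanishesInProbability μ fun n ω => ‖(√(n : ℝ))⁻¹ • ∑ i,
      fderivWithin ℝ (excess D S (X n ω i) (W n ω i)) (box l u B) pstar (U n ω i)‖)
    (ha : Tendsto (fun n : ℕ => (n : ℝ) * a n) atTop (𝓝 0))
    (hclear : ∀ᶠ n in atTop, ∀ᵐ ω ∂μ, P n ω ∈ box l u 0 ∧
      ‖avgExcess D S (X n ω) (W n ω) (U n ω) (P n ω)‖ ≤ a n) :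
    TendstoInDistribution (fun (n : ℕ) ω => √(n : ℝ) • (P n ω - pstar)) atTop id
      (fun _ => μ) (multivariateGaussian 0 (asympCov Θ D S π l u pstar)) := by
  have hD := hM.demand_regular
  have hS := hM.supply_regular
  have hK := uniqueDiffOn_box hlu hB
  have hZ := isRegular_excess hK hD hS
  have hstarK := box_mono hB hstar.1
  obtain ⟨C, hC0, hCb, hCd, -, hCq⟩ := hZ.exists_bounds hK convex_box
  -- rates of the clearing error
  have hle (n : ℕ) (hn : 0 < n) : |a n| ≤ |(n : ℝ) * a n| ∧ √(n : ℝ) * |a n| ≤ |(n : ℝ) * a n| := by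
    have h1 : (1 : ℝ) ≤ n := by exact_mod_cast hn
    have h2 : √(n : ℝ) ≤ n := by
      rw [Real.sqrt_le_iff]
      constructor <;> nlinarith
    rw [abs_mul, Nat.abs_cast]
    constructor <;> nlinarith [abs_nonneg (a n)]
  have habs : Tendsto (fun n : ℕ => |(n : ℝ) * a n|) atTop (𝓝 0) := by
    simpa using ha.abs
  have ha0 : Tendsto a atTop (𝓝 0) := by
    refine squeeze_zero_norm' ?_ habs
    filter_upwards [eventually_gt_atTop 0] with n hn using (hle n hn).1
  have hra : Tendsto (fun n : ℕ => √(n : ℝ) * |a n|) atTop (𝓝 0) := by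
    refine squeeze_zero' (Eventually.of_forall fun n => by positivity) ?_ habs
    filter_upwards [eventually_gt_atTop 0] with n hn using (hle n hn).2
  have hcons := vanishesInProbability_norm_sub_pstar hlu hB hD hS hM.contraction hstar hlaw hh hhB
    hU ha0 hclear
  -- the inverse Jacobian
  set G : Price J →L[ℝ] Price J :=
    Matrix.toEuclideanCLM (𝕜 := ℝ) (jacobian Θ D S π l u pstar)⁻¹ with hG
  have hGA : ∀ v, G (meanDeriv Θ D S π l u B pstar v) = v := fun v => by
    rw [← toEuclideanCLM_jacobian hD hS hlu hB hstar.1, hG, ← mul_apply_eq_comp,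
      ← map_mul, Matrix.nonsing_inv_mul _
        ((Matrix.isUnit_iff_isUnit_det _).1 (isUnit_of_rank_eq hM.jacobian_full_rank)), map_one,
      one_apply_eq_self]
  -- the leading term
  let φ : 𝒢 × Bool → Price J := fun b => -G (excess D S b.1 b.2 pstar)
  have hφm : Measurable φ := by
    have := hZ.measurable_uncurry hstarK
    fun_prop
  have hφb : ∀ b, ‖φ b‖ ≤ ‖G‖ * C := fun b => by
    rw [norm_neg]
    exact (G.le_opNorm _).trans
      (mul_le_mul_of_nonneg_left (hCb b.1 b.2 pstar hstarK) (norm_nonneg _))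
  have hφ0 : ∫ b, φ b ∂(agentLaw Θ π) = 0 := by
    simp only [φ]
    rw [integral_neg, G.integral_comp_comm (hZ.integrable hstarK),
      ← meanExcess_eq_integral hD hS hZ hstarK, hstar.2, map_zero, neg_zero]
  have hclt := tendstoInDistribution_inv_sqrt_smul_sum hlaw hφm
    (MemLp.of_bound hφm.aestronglyMeasurable _ (ae_of_all _ hφb)) hφ0
  rw [asympCov_eq hZ hstarK]
  -- Slutsky: it suffices that the difference from the leading term vanishes in probability.
  refine tendstoInDistribution_of_tendstoInMeasure_sub _ _ hclt ?_ fun n =>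
    (((hP n).sub_const pstar).const_smul √(n : ℝ) :)
  refine VanishesInProbability.tendstoInMeasure ?_
  -- the error terms
  have hb := ((VanishesInProbability.of_tendsto (μ := μ) hra).add hT).add
    (VanishesInProbability.of_tendsto (μ := μ)
      (by simpa using hh2.const_mul (2 * C * (J : ℝ) ^ 2)))
  have hκ := VanishesInProbability.sum Finset.univ fun k (_ : k ∈ Finset.univ) =>
    vanishesInProbability_norm_sum_sub (c := fun n => (n : ℝ)⁻¹) (C := fun _ => C) hlaw
      (hZ.measurable_fderivWithin hlu hB hstar.1 k)
      (fun n => ae_of_all _ fun b => by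
        refine (ContinuousLinearMap.le_opNorm _ _).trans ?_
        simpa using hCd b.1 b.2 pstar hstarK) (tendsto_natCast_mul_inv_mul_sq C)
  simp only [← meanDeriv_single] at hκ
  -- The multiple of `‖√n δ‖` has two parts: the error of the averaged Jacobian, and `2 * C * ‖δ‖`,
  -- for which consistency was needed.
  refine vanishesInProbability_norm_sub_of_le
    (fun n ω => by positivity) (hb.const_mul (norm_nonneg G))
    ((hκ.add (hcons.const_mul (by positivity : 0 ≤ 2 * C))).const_mul (norm_nonneg G))
    (uniformlyTight_norm_inv_sqrt_smul_sum hlaw hφm (ae_of_all _ hφb) hφ0) ?_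
  filter_upwards [hclear, hhB, eventually_gt_atTop 0] with n hn hnB hnpos
  filter_upwards [hn, hU n] with ω hω hωU
  have hexp := norm_sqrt_smul_sub_le hnpos hGA hC0 (b := J * h n) (δ := P n ω - pstar)
    (U := U n ω) (z₀ := fun i => excess D S (X n ω i) (W n ω i) pstar)
    (z₁ := fun i => excess D S (X n ω i) (W n ω i) (P n ω + U n ω i))
    (d := fun i => fderivWithin ℝ (excess D S (X n ω i) (W n ω i)) (box l u B) pstar)
    (fun i => by
      have h1 := hCq (X n ω i) (W n ω i) pstar hstarK _
        (add_mem_box hω.1 fun j => (hωU i j).trans hnB)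
      rwa [add_sub_right_comm] at h1)
    (fun i => norm_le_mul_of_abs_le (hωU i))
  refine hexp.trans (add_le_add_left (mul_le_mul_of_nonneg_left ?_ (norm_nonneg G)) _)
  have h2 : ‖(n : ℝ)⁻¹ • ∑ i, excess D S (X n ω i) (W n ω i) (P n ω + U n ω i)‖ ≤ |a n| := by
    rw [← one_div]
    exact hω.2.trans (le_abs_self _)
  refine add_le_add (add_le_add_left (mul_le_mul_of_nonneg_left h2 (Real.sqrt_nonneg _)) _)
    (le_of_eq (by ring))

end Asymptotics

theorem ae_pi_forall {ι α : Type*} [Fintype ι] [MeasurableSpace α] {ν : Measure α}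
    [IsProbabilityMeasure ν] {p : α → Prop} (h : ∀ᵐ a ∂ν, p a) :
    ∀ᵐ x ∂(Measure.pi fun _ : ι => ν), ∀ i, p (x i) :=
  ae_all_iff.2 fun i =>
    (measurePreserving_eval (fun _ : ι => ν) i).quasiMeasurePreserving.ae h

/-- The only use of minimality: the minimizer clears at least as well as the approximate clearing
price that is assumed to exist. -/
theorem IsMarketPrice.mem_and_norm_le {J : ℕ} {𝒢 : Type*}
    {D S : 𝒢 → Bool → Price J → Price J} {l u : Price J} {n : ℕ} {x : Fin n → 𝒢} {w : Fin n → Bool}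
    {U : Fin n → Price J} {p : Price J} {a : ℝ} (hp : IsMarketPrice D S l u x w U p)
    (h : ∃ q ∈ box l u 0, ‖avgExcess D S x w U q‖ ≤ a) :
    p ∈ box l u 0 ∧ ‖avgExcess D S x w U p‖ ≤ a := by
  obtain ⟨q, hq, hqa⟩ := h
  exact ⟨hp.1, (hp.2 q hq).trans hqa⟩

/-! ### Random sign perturbations -/

section Perturbation

variable {J : ℕ} {𝒢 Ω : Type*} [MeasurableSpace 𝒢] [MeasurableSpace Ω] {μ : Measure Ω}
  {Θ : Measure 𝒢}
  {D S : 𝒢 → Bool → Price J → Price J} {π : unitInterval} {l u : Price J} {B : ℝ}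

instance (h : ℝ) : IsProbabilityMeasure (perturbLaw J h) :=
  Measure.isProbabilityMeasure_map (by fun_prop)

theorem ae_perturbLaw (h : ℝ) : ∀ᵐ v ∂(perturbLaw J h), ∀ j, v j = h ∨ v j = -h := by
  have hm : MeasurableSet {v : Price J | ∀ j, v j = h ∨ v j = -h} := by
    have : {v : Price J | ∀ j, v j = h ∨ v j = -h} =
        ⋂ j, (fun v : Price J => v j) ⁻¹' {h, -h} := by
      ext v
      simp
    rw [this]
    exact MeasurableSet.iInter fun j => measurableSet_preimage (by fun_prop) (by measurability)
  rw [perturbLaw, ae_map_iff (by fun_prop) hm]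
  refine ae_pi_forall (p := fun x => x = h ∨ x = -h) ?_
  have hm' : MeasurableSet {x : ℝ | x = h ∨ x = -h} := by
    have : {x : ℝ | x = h ∨ x = -h} = {h, -h} := rfl
    rw [this]
    measurability
  rw [bernoulliMeasure_def, ae_add_measure_iff]
  exact ⟨Measure.ae_smul_measure ((ae_dirac_iff hm').2 (Or.inl rfl)) _,
    Measure.ae_smul_measure ((ae_dirac_iff hm').2 (Or.inr rfl)) _⟩

theorem ae_norm_perturbLaw_le (h : ℝ) : ∀ᵐ v ∂(perturbLaw J h), ‖v‖ ≤ J * |h| := by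
  filter_upwards [ae_perturbLaw h] with v hv
  refine norm_le_mul_of_abs_le fun j => ?_
  rcases hv j with hj | hj <;> simp [hj]

theorem integral_perturbLaw (h : ℝ) : ∫ v, v ∂(perturbLaw J h) = 0 := by
  have hint : Integrable (fun v : Price J => v) (perturbLaw J h) :=
    Integrable.of_bound (by fun_prop) _ (ae_norm_perturbLaw_le h)
  ext j
  rw [integral_apply hint, perturbLaw, integral_map (by fun_prop) (by fun_prop)]
  refine (integral_comp_eval (i := j)
    (μ := fun _ : Fin J => bernoulliMeasure h (-h) ⟨1 / 2, by norm_num, by norm_num⟩) (f := fun x : ℝ => x) (by fun_prop)).trans ?_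
  rw [integral_bernoulliMeasure]
  simp
  ring

theorem ae_perturbedAgentLaw (h : ℝ) :
    ∀ᵐ b ∂(perturbedAgentLaw Θ π J h), ∀ j, b.2.2 j = h ∨ b.2.2 j = -h :=
  (Measure.quasiMeasurePreserving_snd.comp Measure.quasiMeasurePreserving_snd).ae
    (ae_perturbLaw h)

/-- Approximate market clearing for almost every sample persists under random perturbations with
finitely many values. -/
theorem ae_exists_norm_avgExcess_le {n : ℕ} {X : Ω → Fin n → 𝒢} {W : Ω → Fin n → Bool}
    {U : Ω → Fin n → Price J} (hlaw : HasLaw (fun ω (i : Fin n) => (X ω i, W ω i))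
      (Measure.pi fun _ : Fin n => agentLaw Θ π) μ) {h a : ℝ} (hhB : |h| ≤ B)
    (hU : ∀ᵐ ω ∂μ, ∀ i j, U ω i j = h ∨ U ω i j = -h)
    (hclear : ∀ V : Fin n → Price J, (∀ i j, |V i j| ≤ B) →
      ∀ᵐ s ∂(Measure.pi fun _ : Fin n => agentLaw Θ π), ∃ p ∈ box l u 0,
        ‖avgExcess D S (fun i => (s i).1) (fun i => (s i).2) V p‖ ≤ a) :
    ∀ᵐ ω ∂μ, ∃ p ∈ box l u 0, ‖avgExcess D S (X ω) (W ω) (U ω) p‖ ≤ a := by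
  -- The exceptional null set depends on the perturbation, but there are only finitely many sign
  -- patterns, so the union of these sets is null.
  let V : (Fin n → Fin J → Bool) → Fin n → Price J := fun σ i =>
    WithLp.toLp 2 fun j => if σ i j then h else -h
  have hV : ∀ σ, ∀ᵐ s ∂(Measure.pi fun _ : Fin n => agentLaw Θ π), ∃ p ∈ box l u 0,
      ‖avgExcess D S (fun i => (s i).1) (fun i => (s i).2) (V σ) p‖ ≤ a := fun σ =>
    hclear (V σ) fun i j => by
      simp only [V]
      split_ifs <;> simpa using hhB
  rw [← ae_all_iff, ← hlaw.map_eq] at hV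
  filter_upwards [ae_of_ae_map hlaw.aemeasurable hV, hU] with ω hω hUω
  classical
  have hUV : U ω = V fun i j => decide (U ω i j = h) := by
    funext i
    ext j
    simp only [V, decide_eq_true_eq]
    split_ifs with hij
    · exact hij
    · exact (hUω i j).resolve_left hij
  rw [hUV]
  exact hω _

variable [IsProbabilityMeasure Θ]

instance (h : ℝ) : IsProbabilityMeasure (perturbedAgentLaw Θ π J h) := by
  unfold perturbedAgentLaw
  infer_instance

theorem map_perturbedAgentLaw (h : ℝ) :
    (perturbedAgentLaw Θ π J h).map (fun b => (b.1, b.2.1)) = agentLaw Θ π := by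
  have h1 : (fun b : 𝒢 × Bool × Price J => (b.1, b.2.1)) = Prod.map id Prod.fst := rfl
  rw [h1, perturbedAgentLaw, ← Measure.map_prod_map _ _ measurable_id measurable_fst,
    Measure.map_id, Measure.map_fst_prod]
  simp [agentLaw]

/-- Given type and treatment, the derivative is a fixed linear map applied to a mean-zero vector.
Hence the first-order effect of the perturbations is centered. -/
theorem integral_fderivWithin_perturbedAgentLaw (hZ : IsRegular (excess D S) (box l u B))
    (hlu : ∀ j, l j < u j) (hB : 0 ≤ B) {p : Price J} (hp : p ∈ box l u 0) (h : ℝ) :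
    ∫ b, fderivWithin ℝ (excess D S b.1 b.2.1) (box l u B) p b.2.2
      ∂(perturbedAgentLaw Θ π J h) = 0 := by
  obtain ⟨C, hC0, -, hC, -⟩ := hZ.exists_bounds (uniqueDiffOn_box hlu hB) convex_box
  have hint : Integrable (fun b : 𝒢 × Bool × Price J =>
      fderivWithin ℝ (excess D S b.1 b.2.1) (box l u B) p b.2.2)
      (perturbedAgentLaw Θ π J h) := by
    refine Integrable.of_bound (measurable_fderivWithin_apply hZ hlu hB hp).aestronglyMeasurable
      (C * (J * |h|)) ?_
    filter_upwards [ae_perturbedAgentLaw h] with b hb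
    refine (ContinuousLinearMap.le_opNorm _ _).trans (mul_le_mul (hC _ _ p (box_mono hB hp))
      (norm_le_mul_of_abs_le fun j => ?_) (norm_nonneg _) hC0)
    rcases hb j with hj | hj <;> simp [hj]
  have hv : Integrable (fun v : Price J => v) (perturbLaw J h) :=
    Integrable.of_bound (by fun_prop) _ (ae_norm_perturbLaw_le h)
  unfold perturbedAgentLaw at hint ⊢
  rw [integral_prod _ hint]
  refine integral_eq_zero_of_ae ?_
  filter_upwards [hint.prod_right_ae] with g hg
  rw [integral_prod _ hg]
  refine integral_eq_zero_of_ae (ae_of_all _ fun w => ?_)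
  change ∫ v, fderivWithin ℝ (excess D S g w) (box l u B) p v ∂(perturbLaw J h) = 0
  rw [ContinuousLinearMap.integral_comp_comm _ hv, integral_perturbLaw, map_zero]

theorem tendsto_abs_const_mul_rpow_neg (c : ℝ) {α : ℝ} (hα : 0 < α) :
    Tendsto (fun n : ℕ => |c * (n : ℝ) ^ (-α)|) atTop (𝓝 0) := by
  have := (((tendsto_rpow_neg_atTop hα).comp tendsto_natCast_atTop_atTop).const_mul c).abs
  simpa using this

/-- Source of the threshold 1/4: the expression equals `c² n^(-(2α - 1/2))`. -/
theorem tendsto_sqrt_mul_const_mul_rpow_neg_sq (c : ℝ) {α : ℝ} (hα : 1 / 4 < α) :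
    Tendsto (fun n : ℕ => √(n : ℝ) * |c * (n : ℝ) ^ (-α)| ^ 2) atTop (𝓝 0) := by
  have h := ((tendsto_rpow_neg_atTop (by linarith : 0 < 2 * α - 1 / 2)).comp
    tendsto_natCast_atTop_atTop).const_mul (c ^ 2)
  rw [mul_zero] at h
  refine h.congr' ?_
  filter_upwards [eventually_gt_atTop 0] with n hn
  have hn' : (0 : ℝ) < n := by exact_mod_cast hn
  rw [sq_abs, mul_pow, Real.sqrt_eq_rpow, ← Real.rpow_natCast ((n : ℝ) ^ (-α)) 2,
    ← Real.rpow_mul hn'.le]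
  simp only [Function.comp_apply]
  rw [mul_left_comm, ← Real.rpow_add hn']
  congr 2
  push_cast
  ring

end Perturbation

/-! ### The two markets as special cases -/

section Market

variable {J : ℕ} {𝒢 Ω : Type*} [MeasurableSpace 𝒢] [MeasurableSpace Ω] {μ : Measure Ω}
  [IsProbabilityMeasure μ] {Θ : Measure 𝒢} [IsProbabilityMeasure Θ]
  {D S : 𝒢 → Bool → Price J → Price J} {π : unitInterval} {l u : Price J} {B : ℝ}
  {pstar : Price J}

theorem tendstoInDistribution_marketPrice (hlu : ∀ j, l j < u j) (hB : 0 ≤ B)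
    (hstar : IsMeanFieldPrice Θ D S π l u pstar) (hM : Assumptions Θ D S π l u B pstar)
    {X : (n : ℕ) → Ω → Fin n → 𝒢} {W : (n : ℕ) → Ω → Fin n → Bool} {P : ℕ → Ω → Price J}
    (hlaw : ∀ n, HasLaw (fun ω (i : Fin n) => (X n ω i, W n ω i))
      (Measure.pi fun _ : Fin n => agentLaw Θ π) μ)
    (hP : ∀ n, AEMeasurable (P n) μ)
    (hprice : ∀ᶠ n in atTop, ∀ᵐ ω ∂μ, IsMarketPrice D S l u (X n ω) (W n ω) 0 (P n ω)) :
    TendstoInDistribution (fun (n : ℕ) ω => √(n : ℝ) • (P n ω - pstar)) atTop id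
      (fun _ => μ) (multivariateGaussian 0 (asympCov Θ D S π l u pstar)) := by
  obtain ⟨a, ha, hclear⟩ := hM.approx_clearing
  refine tendstoInDistribution_sqrt_smul_sub_pstar (U := fun _ _ => 0) (h := fun _ => 0) (a := a)
    hlu hB hstar hM hlaw hP tendsto_const_nhds (by simp) (Eventually.of_forall fun _ => hB)
    (fun n => ae_of_all _ fun ω i j => by simp) ?_ ha ?_
  · simpa using VanishesInProbability.of_tendsto (μ := μ) tendsto_const_nhds
  · filter_upwards [hprice, hclear] with n hn hcn
    have h0 := hcn 0 fun i j => by simpa using hB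
    rw [← (hlaw n).map_eq] at h0
    filter_upwards [hn, ae_of_ae_map (hlaw n).aemeasurable h0] with ω h1 h2
    exact h1.mem_and_norm_le h2

theorem tendstoInDistribution_perturbedMarketPrice (hlu : ∀ j, l j < u j) (hB : 0 < B)
    (hstar : IsMeanFieldPrice Θ D S π l u pstar) (hM : Assumptions Θ D S π l u B pstar)
    {c α : ℝ} (hα : 1 / 4 < α)
    {X : (n : ℕ) → Ω → Fin n → 𝒢} {W : (n : ℕ) → Ω → Fin n → Bool}
    {U : (n : ℕ) → Ω → Fin n → Price J} {P : ℕ → Ω → Price J}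
    (hlaw : ∀ n, HasLaw (fun ω (i : Fin n) => (X n ω i, W n ω i, U n ω i))
      (Measure.pi fun _ : Fin n => perturbedAgentLaw Θ π J (c * (n : ℝ) ^ (-α))) μ)
    (hP : ∀ n, AEMeasurable (P n) μ)
    (hprice : ∀ᶠ n in atTop, ∀ᵐ ω ∂μ, IsMarketPrice D S l u (X n ω) (W n ω) (U n ω) (P n ω)) :
    TendstoInDistribution (fun (n : ℕ) ω => √(n : ℝ) • (P n ω - pstar)) atTop id
      (fun _ => μ) (multivariateGaussian 0 (asympCov Θ D S π l u pstar)) := by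
  obtain ⟨a, ha, hclear⟩ := hM.approx_clearing
  have hZ := isRegular_excess (uniqueDiffOn_box hlu hB.le) hM.demand_regular hM.supply_regular
  obtain ⟨C, hC0, -, hC, -⟩ := hZ.exists_bounds (uniqueDiffOn_box hlu hB.le) convex_box
  have hlaw' (n : ℕ) : HasLaw (fun ω (i : Fin n) => (X n ω i, W n ω i))
      (Measure.pi fun _ : Fin n => agentLaw Θ π) μ := by
    refine HasLaw.comp (Y := fun (s : Fin n → 𝒢 × Bool × Price J) i => ((s i).1, (s i).2.1))
      ⟨by fun_prop, ?_⟩ (hlaw n)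
    have := Measure.pi_map_pi (μ := fun _ : Fin n => perturbedAgentLaw Θ π J (c * (n : ℝ) ^ (-α)))
      (f := fun _ b => (b.1, b.2.1))
      (hμ := fun _ => by rw [map_perturbedAgentLaw]; infer_instance) (fun _ => by fun_prop)
    rw [this]
    simp only [map_perturbedAgentLaw]
  have hUae (n : ℕ) : ∀ᵐ ω ∂μ, ∀ i j,
      U n ω i j = c * (n : ℝ) ^ (-α) ∨ U n ω i j = -(c * (n : ℝ) ^ (-α)) := by
    have h1 : ∀ᵐ s ∂(Measure.pi fun _ : Fin n => perturbedAgentLaw Θ π J (c * (n : ℝ) ^ (-α))),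
        ∀ i j, (s i).2.2 j = c * (n : ℝ) ^ (-α) ∨ (s i).2.2 j = -(c * (n : ℝ) ^ (-α)) :=
      ae_pi_forall (ae_perturbedAgentLaw _)
    rw [← (hlaw n).map_eq] at h1
    exact ae_of_ae_map (hlaw n).aemeasurable h1
  have hlim := tendsto_abs_const_mul_rpow_neg c (by linarith : 0 < α)
  -- A positive margin is what eventually accommodates the perturbations.
  have hhB : ∀ᶠ n : ℕ in atTop, |c * (n : ℝ) ^ (-α)| ≤ B := hlim.eventually_le_const hB
  refine tendstoInDistribution_sqrt_smul_sub_pstar (U := U) (a := a)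
    (h := fun n => |c * (n : ℝ) ^ (-α)|) hlu hB.le hstar hM hlaw' hP hlim
    (tendsto_sqrt_mul_const_mul_rpow_neg_sq c hα) hhB (fun n => ?_) ?_ ha ?_
  · filter_upwards [hUae n] with ω hω i j
    rcases hω i j with hj | hj <;> simp [hj]
  -- The summands are centered and bounded by a multiple of `|h_n|`, so even with the normalization
  -- `n^(-1/2)` Chebyshev's bound is of order `h_n²`; here `h_n → 0` suffices.
  · have h := vanishesInProbability_norm_sum_sub (c := fun n => (√(n : ℝ))⁻¹) hlaw
      (measurable_fderivWithin_apply hZ hlu hB.le hstar.1)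
      (C := fun n : ℕ => C * (J * |c * (n : ℝ) ^ (-α)|)) (fun n => by
        filter_upwards [ae_perturbedAgentLaw (c * (n : ℝ) ^ (-α))] with b hb
        refine (ContinuousLinearMap.le_opNorm _ _).trans
          (mul_le_mul (hC _ _ pstar (box_mono hB.le hstar.1))
            (norm_le_mul_of_abs_le fun j => ?_) (norm_nonneg _) hC0)
        rcases hb j with hj | hj <;> simp [hj]) ?_
    · simpa only [integral_fderivWithin_perturbedAgentLaw hZ hlu hB.le hstar.1, smul_zero,
        sub_zero] using h
    · have h2 := ((hlim.const_mul (J : ℝ)).const_mul C).pow 2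
      simp only [mul_zero, ne_eq, OfNat.ofNat_ne_zero, not_false_eq_true, zero_pow] at h2
      refine h2.congr' ?_
      filter_upwards [eventually_gt_atTop 0] with n hn
      have hn' : (n : ℝ) ≠ 0 := by exact_mod_cast hn.ne'
      rw [mul_pow (√(n : ℝ))⁻¹, inv_pow, Real.sq_sqrt (Nat.cast_nonneg n),
        mul_inv_cancel_left₀ hn']
  · filter_upwards [hprice, hclear, hhB] with n hn hcn hnB
    filter_upwards [hn, ae_exists_norm_avgExcess_le (hlaw' n) hnB (hUae n) hcn] with ω h1 h2
    exact h1.mem_and_norm_le h2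

end Market

end Market

theorem mainTheorem2 {J : ℕ} {𝒢 Ω : Type*} [MeasurableSpace 𝒢] [MeasurableSpace Ω]
    (μ : Measure Ω) [IsProbabilityMeasure μ] (Θ : Measure 𝒢) [IsProbabilityMeasure Θ]
    (D S : 𝒢 → Bool → Market.Price J → Market.Price J) (π : unitInterval)
    (l u : Market.Price J) (hlu : ∀ j, l j < u j) (B : ℝ) (hB : 0 ≤ B)
    (pstar : Market.Price J) (hpstar : Market.IsMeanFieldPrice Θ D S π l u pstar)
    (hM : Market.Assumptions Θ D S π l u B pstar) :
    -- the unperturbed market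
    (∀ (X : (n : ℕ) → Ω → Fin n → 𝒢) (W : (n : ℕ) → Ω → Fin n → Bool)
        (P : ℕ → Ω → Market.Price J),
      (∀ n, HasLaw (fun ω (i : Fin n) => (X n ω i, W n ω i))
        (Measure.pi fun _ : Fin n => Market.agentLaw Θ π) μ) →
      (∀ n, AEMeasurable (P n) μ) →
      (∀ᶠ n in atTop, ∀ᵐ ω ∂μ, Market.IsMarketPrice D S l u (X n ω) (W n ω) 0 (P n ω)) →
      TendstoInDistribution (fun (n : ℕ) ω => √(n : ℝ) • (P n ω - pstar)) atTop id
        (fun _ => μ) (multivariateGaussian 0 (Market.asympCov Θ D S π l u pstar))) ∧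
    -- the perturbed market
    (0 < B → ∀ (c α : ℝ), 1 / 4 < α →
      ∀ (X : (n : ℕ) → Ω → Fin n → 𝒢) (W : (n : ℕ) → Ω → Fin n → Bool)
        (U : (n : ℕ) → Ω → Fin n → Market.Price J) (P : ℕ → Ω → Market.Price J),
      (∀ n, HasLaw (fun ω (i : Fin n) => (X n ω i, W n ω i, U n ω i))
        (Measure.pi fun _ : Fin n =>
          Market.perturbedAgentLaw Θ π J (c * (n : ℝ) ^ (-α))) μ) →
      (∀ n, AEMeasurable (P n) μ) →
      (∀ᶠ n in atTop, ∀ᵐ ω ∂μ, Market.IsMarketPrice D S l u (X n ω) (W n ω) (U n ω) (P n ω)) →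
      TendstoInDistribution (fun (n : ℕ) ω => √(n : ℝ) • (P n ω - pstar)) atTop id
        (fun _ => μ) (multivariateGaussian 0 (Market.asympCov Θ D S π l u pstar))) := ⟨fun _ _ _ hlaw hP hprice =>
    Market.tendstoInDistribution_marketPrice hlu hB hpstar hM hlaw hP hprice,
  fun hB' _ _ hα _ _ _ _ hlaw hP hprice =>
    Market.tendstoInDistribution_perturbedMarketPrice hlu hB' hpstar hM hα hlaw hP hprice⟩
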